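/- Let $R$ be a complete admissible ring, i.e. a one-dimensional Noetherian local ring, complete for the topology of its maximal ideal, Cohen--Macaulay, analytically reduced, residually rational (every residue field of the integral closure of $R$ in its total ring of fractions $K$ equals the residue field of $R$), and whose residue field has at least as many elements as $R$ has minimal primes. Assume that $R$ has exactly three minimal primes $\wp_1,\wp_2,\wp_3$. For $\emptyset\ne J\subseteq\{1,2,3\}$ put $R_J=R/\bigcap_{j\in J}\wp_j$, let $K_J$ be its total ring of fractions and $\pi_J\colon K\to K_J$ the projection; write $\pi_i,K_i$ for $J=\{i\}$. The integral closure of $R/\wp_i$ in $K_i$ is a discrete valuation ring; let $v_i\colon K_i\to\mathbb Z\cup\{\infty\}$ be its normalized valuation. Let $\mathcal I\subset K$ be a regular fractional ideal of $R$: an $R$-submodule that contains a regular element of $R$ and satisfies $d\,\mathcal I\subseteq R$ for some regular $d\in R$. Let $$E=\{(v_i(\pi_i(h)))_{i=1,2,3} : h\in\mathcal I \text{ not a zero divisor of } K\}\subset\mathbb Z^3$$ be its value set, and let $E_J\subset\mathbb Z^J$ be the set of the vectors $(v_j(g_j))_{j\in J}$, where $g\in\pi_J(\mathcal I)$ is not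 a zero divisor of $K_J$ and $g_j$ is its image in $K_j$; write $E_i=E_{\{i\}}\subset\mathbb Z$. For $\gamma\in\mathbb Z^3$ put $\mathcal I(\gamma)=\{h\in\mathcal I : v_i(\pi_i(h))\ge\gamma_i,\ i=1,2,3\}$, and let $\mathcal L(E_i)$ be the set of integers $n>\min E_i$ with $n\notin E_i$. For a finite index set $T$, $A\subset\mathbb Z^T$, $\alpha\in\mathbb Z^T$ and $\emptyset\neq J\subseteq T$ let $F_J(A,\alpha)$ be the set of $\beta\in A$ with $\beta_j=\alpha_j$ for $j\in J$ and $\beta_j>\alpha_j$ for $j\in T\setminus J$. A point $\alpha\in A$ is maximal if $F_{\{i\}}(A,\alpha)=\emptyset$ for all $i\in T$. A maximal point $\alpha$ is an absolute maximal if $F_J(A,\alpha)=\emptyset$ for all $\emptyset\ne J\subsetneq T$, and a relative maximal if $F_J(A,\alpha)\neq\emptyset$ for all $J\subseteq T$ with $\#J\ge2$. Let $M(A)$, $AM(A)$, $RM(A)$ be the sets of maximals, absolute maximals and relative maximals of $A$. Then, for the product order, $E$ has a least element $\alpha^0$ and a conductor $c(E)$, the least $\delta\in\mathbb Z^3$ with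 $\delta+\mathbb N^3\subseteq E$; the sets $\mathcal L(E_i)$, $M(E_{\{i,j\}})$ $(i<j)$, $RM(E)$, $AM(E)$ are finite; and for every $\gamma\ge c(E)$ the $R$-module $\mathcal I/\mathcal I(\gamma)$ has finite length, equal to $$\ell_R\!\left(\frac{\mathcal I}{\mathcal I(\gamma)}\right)=\sum_{i=1}^{3}\bigl((\gamma_i-\alpha^0_i)-\#\mathcal L(E_i)\bigr)-\sum_{1\le i<j\le 3}\#M(E_{\{i,j\}})-\#RM(E)+\#AM(E).$$ -/

import Mathlib

open scoped nonZeroDivisors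

noncomputable section

namespace AdmissibleRing

universe u

section DVR

variable (A K : Type*) [CommRing A] [IsDomain A] [IsDiscreteValuationRing A] [Field K]
  [Algebra A K] [IsFractionRing A K]

open Classical in
/-- The normalized valuation, with values in `ℤ ∪ {∞}`, of the field of fractions `K` of a
discrete valuation ring `A`. -/
def dvrVal (x : K) : WithTop ℤ :=
  if x = 0 then ⊤
  else ((-WithZero.log ((IsDiscreteValuationRing.maximalIdeal A).valuation K x) : ℤ) : WithTop ℤ)

theorem le_dvrVal_iff (n : ℤ) (x : K) : (n : WithTop ℤ) ≤ dvrVal A K x ↔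
    (IsDiscreteValuationRing.maximalIdeal A).valuation K x ≤ WithZero.exp (-n) := by
  by_cases hx : x = 0
  · simp [dvrVal, hx]
  · rw [dvrVal, if_neg hx, WithTop.coe_le_coe, ← WithZero.log_le_iff_le_exp
      ((Valuation.ne_zero_iff _).2 hx)]
    omega

theorem le_dvrVal_add (n : ℤ) (x y : K) (hx : (n : WithTop ℤ) ≤ dvrVal A K x)
    (hy : (n : WithTop ℤ) ≤ dvrVal A K y) : (n : WithTop ℤ) ≤ dvrVal A K (x + y) := by
  rw [le_dvrVal_iff] at *
  exact Valuation.map_add_le _ hx hy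

theorem le_dvrVal_mul (n : ℤ) (a : A) (x : K) (hx : (n : WithTop ℤ) ≤ dvrVal A K x) :
    (n : WithTop ℤ) ≤ dvrVal A K (algebraMap A K a * x) := by
  rw [le_dvrVal_iff] at *
  rw [map_mul]
  exact (mul_le_of_le_one_left'
    ((IsDiscreteValuationRing.maximalIdeal A).valuation_le_one a)).trans hx

end DVR

section Branches

variable {R : Type u} [CommRing R]

/-- The branch `R_P = R / P` at a minimal prime `P` of `R`. -/
abbrev Branch (P : minimalPrimes R) : Type u := R ⧸ P.1

instance branchIsDomain (P : minimalPrimes R) : IsDomain (Branch P) :=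
  have : P.1.IsPrime := P.2.1.1
  Ideal.Quotient.isDomain P.1

/-- The field of fractions `K_P` of the branch `R / P`. -/
abbrev BranchField (P : minimalPrimes R) : Type u := FractionRing (Branch P)

/-- The integral closure of the branch `R / P` in its field of fractions. -/
abbrev BranchNormalization (P : minimalPrimes R) : Subalgebra (Branch P) (BranchField P) :=
  integralClosure (Branch P) (BranchField P)

instance branchNormalizationIsFractionRing (P : minimalPrimes R) :
    IsFractionRing (BranchNormalization P) (BranchField P) :=
  integralClosure.isFractionRing_of_finite_extension (A := Branch P) (BranchField P)
    (BranchField P)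

open Classical in
/-- The normalized valuation of the field `K_P`, with values in `ℤ ∪ {∞}`, given by the discrete
valuation ring `BranchNormalization P`. (The last, conventional value is not used: for the
rings considered below, the normalization of a branch is a discrete valuation ring.) -/
def branchVal (P : minimalPrimes R) (x : BranchField P) : WithTop ℤ :=
  if _h : IsDiscreteValuationRing (BranchNormalization P) then
    dvrVal (BranchNormalization P) (BranchField P) x
  else if x = 0 then ⊤ else 0

theorem branchVal_zero (P : minimalPrimes R) : branchVal P 0 = ⊤ := by
  by_cases h : IsDiscreteValuationRing (BranchNormalization P) <;> simp [branchVal, dvrVal, h]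

theorem le_branchVal_add (P : minimalPrimes R) (n : ℤ) (x y : BranchField P)
    (hx : (n : WithTop ℤ) ≤ branchVal P x) (hy : (n : WithTop ℤ) ≤ branchVal P y) :
    (n : WithTop ℤ) ≤ branchVal P (x + y) := by
  by_cases h : IsDiscreteValuationRing (BranchNormalization P)
  · simp only [branchVal, h, dif_pos] at hx hy ⊢
    exact le_dvrVal_add _ _ n x y hx hy
  · by_cases hx0 : x = 0
    · simpa [hx0] using hy
    by_cases hxy : x + y = 0
    · simp [branchVal, hxy, h]
    simpa [branchVal, hx0, hxy, h] using hx

theorem le_branchVal_mul (P : minimalPrimes R) (n : ℤ) (a : Branch P) (x : BranchField P)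
    (hx : (n : WithTop ℤ) ≤ branchVal P x) :
    (n : WithTop ℤ) ≤ branchVal P (algebraMap (Branch P) (BranchField P) a * x) := by
  by_cases h : IsDiscreteValuationRing (BranchNormalization P)
  · simp only [branchVal, h, dif_pos] at hx ⊢
    exact le_dvrVal_mul _ _ n (algebraMap (Branch P) (BranchNormalization P) a) x hx
  · by_cases hax : algebraMap (Branch P) (BranchField P) a * x = 0
    · simp only [branchVal, hax, h]
      simp
    simp only [branchVal, hax, right_ne_zero_of_mul hax, h] at hx ⊢
    exact hx

/-- A regular element of `R` stays regular modulo a minimal prime. -/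
theorem nonZeroDivisors_le_comap_branch (P : minimalPrimes R) :
    R⁰ ≤ (Branch P)⁰.comap (Ideal.Quotient.mk P.1) := by
  intro x hx
  rw [Submonoid.mem_comap, mem_nonZeroDivisors_iff_ne_zero, Ne, Ideal.Quotient.eq_zero_iff_mem]
  exact fun h => Set.disjoint_left.mp (Ideal.disjoint_nonZeroDivisors_of_mem_minimalPrimes P.2) h hx

/-- The projection `π_P : K → K_P` from the total ring of fractions of `R`. -/
def projBranch (P : minimalPrimes R) : FractionRing R →+* BranchField P :=
  IsLocalization.map (BranchField P) (Ideal.Quotient.mk P.1) (nonZeroDivisors_le_comap_branch P)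

variable {ι : Type*} (p : ι → minimalPrimes R)

/-- The intersection of the minimal primes with index in `J`. -/
def interIdeal (J : Finset ι) : Ideal R := ⨅ j ∈ J, (p j).1

/-- The ring `R_J`, the quotient of `R` by the intersection of the minimal primes indexed by `J`. -/
abbrev PartialRing (J : Finset ι) : Type u := R ⧸ interIdeal p J

/-- The total ring of fractions `K_J` of `R_J`. -/
abbrev PartialFractions (J : Finset ι) : Type u := FractionRing (PartialRing p J)

theorem interIdeal_le (J : Finset ι) (j : J) : interIdeal p J ≤ (p j).1 :=
  iInf₂_le j.1 j.2

theorem nonZeroDivisors_le_comap_partial (J : Finset ι) :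
    R⁰ ≤ (PartialRing p J)⁰.comap (Ideal.Quotient.mk (interIdeal p J)) := by
  intro x hx
  rw [Submonoid.mem_comap, mem_nonZeroDivisors_iff_right]
  intro z hz
  obtain ⟨y, rfl⟩ := Ideal.Quotient.mk_surjective z
  rw [← map_mul, Ideal.Quotient.eq_zero_iff_mem] at hz
  rw [Ideal.Quotient.eq_zero_iff_mem]
  simp only [interIdeal, Ideal.mem_iInf] at hz ⊢
  intro j hj
  have : (p j).1.IsPrime := (p j).2.1.1
  exact (this.mem_or_mem (hz j hj)).resolve_right fun h =>
    Set.disjoint_left.mp (Ideal.disjoint_nonZeroDivisors_of_mem_minimalPrimes (p j).2) h hx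

/-- The projection `π_J : K → K_J`. -/
def projPartial (J : Finset ι) : FractionRing R →+* PartialFractions p J :=
  IsLocalization.map (PartialFractions p J) (Ideal.Quotient.mk (interIdeal p J))
    (nonZeroDivisors_le_comap_partial p J)

theorem nonZeroDivisors_le_comap_factor (J : Finset ι) (j : J) :
    (PartialRing p J)⁰ ≤ (Branch (p j))⁰.comap (Ideal.Quotient.factor (interIdeal_le p J j)) := by
  intro x hx
  obtain ⟨a, rfl⟩ := Ideal.Quotient.mk_surjective x
  have hprime : (p j).1.IsPrime := (p j).2.1.1
  rw [Submonoid.mem_comap, mem_nonZeroDivisors_iff_ne_zero, Ne, Ideal.Quotient.factor_mk,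
    Ideal.Quotient.eq_zero_iff_mem]
  intro ha
  let q : Ideal (PartialRing p J) := (p j).1.map (Ideal.Quotient.mk (interIdeal p J))
  have hcomap : q.comap (Ideal.Quotient.mk (interIdeal p J)) = (p j).1 := by
    rw [Ideal.comap_map_of_surjective _ Ideal.Quotient.mk_surjective, ← RingHom.ker_eq_comap_bot,
      Ideal.mk_ker, sup_eq_left]
    exact interIdeal_le p J j
  have hq : q ∈ minimalPrimes (PartialRing p J) := by
    refine ⟨⟨?_, bot_le⟩, ?_⟩
    · exact Ideal.map_isPrime_of_surjective Ideal.Quotient.mk_surjective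
        (by rw [Ideal.mk_ker]; exact interIdeal_le p J j)
    · rintro q' ⟨hq', -⟩ hle
      have h1 : q'.comap (Ideal.Quotient.mk (interIdeal p J)) ≤ (p j).1 :=
        hcomap ▸ Ideal.comap_mono hle
      have h2 : (p j).1 ≤ q'.comap (Ideal.Quotient.mk (interIdeal p J)) :=
        (p j).2.2 ⟨Ideal.IsPrime.comap _, bot_le⟩ h1
      exact Ideal.map_le_iff_le_comap.2 h2
  exact Set.disjoint_left.mp (Ideal.disjoint_nonZeroDivisors_of_mem_minimalPrimes hq)
    (Ideal.mem_map_of_mem _ ha) hx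

/-- The projection `K_J → K_j`, for `j ∈ J`. -/
def projPartialBranch (J : Finset ι) (j : J) : PartialFractions p J →+* BranchField (p j) :=
  IsLocalization.map (BranchField (p j)) (Ideal.Quotient.factor (interIdeal_le p J j))
    (nonZeroDivisors_le_comap_factor p J j)

/-- The value set `E = v(𝓘 \ Z(K)) ⊆ ℤ^ι`. -/
def valueSet (𝓘 : FractionalIdeal R⁰ (FractionRing R)) : Set (ι → ℤ) :=
  {α | ∃ h ∈ 𝓘, h ∈ (FractionRing R)⁰ ∧
    ∀ i, branchVal (p i) (projBranch (p i) h) = (α i : WithTop ℤ)}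

/-- The value set `E_J = v(π_J(𝓘) \ Z(K_J)) ⊆ ℤ^J`. -/
def partialValueSet (𝓘 : FractionalIdeal R⁰ (FractionRing R)) (J : Finset ι) : Set (J → ℤ) :=
  {β | ∃ g ∈ projPartial p J '' (𝓘 : Set (FractionRing R)), g ∈ (PartialFractions p J)⁰ ∧
    ∀ j : J, branchVal (p j) (projPartialBranch p J j g) = (β j : WithTop ℤ)}

/-- The value set `E_i = E_{i}`, regarded as a set of integers. -/
def singleValueSet (𝓘 : FractionalIdeal R⁰ (FractionRing R)) (i : ι) : Set ℤ :=
  {n | (fun _ => n) ∈ partialValueSet p 𝓘 {i}}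

/-- The submodule `𝓘(α) = {h ∈ 𝓘 ; v(h) ≥ α}` of `𝓘`, where `v_i(h) = ∞` if `π_i(h) = 0`. -/
def truncation (𝓘 : FractionalIdeal R⁰ (FractionRing R)) (α : ι → ℤ) :
    Submodule R (FractionRing R) where
  carrier := {h | h ∈ 𝓘 ∧ ∀ i, (α i : WithTop ℤ) ≤ branchVal (p i) (projBranch (p i) h)}
  zero_mem' := ⟨FractionalIdeal.zero_mem 𝓘, fun i => by simp [branchVal_zero]⟩
  add_mem' := by
    rintro a b ⟨ha, ha'⟩ ⟨hb, hb'⟩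
    refine ⟨(𝓘 : Submodule R (FractionRing R)).add_mem ha hb, fun i => ?_⟩
    rw [map_add]
    exact le_branchVal_add _ _ _ _ (ha' i) (hb' i)
  smul_mem' := by
    rintro r a ⟨ha, ha'⟩
    refine ⟨(𝓘 : Submodule R (FractionRing R)).smul_mem r ha, fun i => ?_⟩
    rw [Algebra.smul_def, map_mul, projBranch, IsLocalization.map_eq]
    exact le_branchVal_mul _ _ _ _ (ha' i)

end Branches

section Maximals

variable {ι : Type*}

/-- `F_J(A, α)`: the points of `A` with the same coordinates as `α` on `J`, and strictly larger
ones outside `J`. -/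
def fiber (J : Finset ι) (A : Set (ι → ℤ)) (α : ι → ℤ) : Set (ι → ℤ) :=
  {β | β ∈ A ∧ (∀ j ∈ J, β j = α j) ∧ ∀ j ∉ J, α j < β j}

/-- The set `M(A)` of maximal points of `A`. -/
def maximals (A : Set (ι → ℤ)) : Set (ι → ℤ) :=
  {α | α ∈ A ∧ ∀ i, fiber {i} A α = ∅}

/-- The set `AM(A)` of absolute maximal points of `A`. -/
def absoluteMaximals [Fintype ι] (A : Set (ι → ℤ)) : Set (ι → ℤ) :=
  {α | α ∈ maximals A ∧ ∀ J : Finset ι, J.Nonempty → J ≠ Finset.univ → fiber J A α = ∅}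

/-- The set `RM(A)` of relative maximal points of `A`. -/
def relativeMaximals (A : Set (ι → ℤ)) : Set (ι → ℤ) :=
  {α | α ∈ maximals A ∧ ∀ J : Finset ι, 2 ≤ J.card → (fiber J A α).Nonempty}

/-- `c` is the conductor of `A`: the least point with `c + ℕ^ι ⊆ A`. -/
def IsConductor (A : Set (ι → ℤ)) (c : ι → ℤ) : Prop :=
  IsLeast {δ | Set.Ici δ ⊆ A} c

/-- The gaps of a set of integers `A` in the interval `(min A, ∞)`. -/
def gaps (A : Set ℤ) : Set ℤ :=
  {n | n ∉ A ∧ ∃ m ∈ A, m < n}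

end Maximals

/-- A local ring is Cohen-Macaulay if its maximal ideal contains a regular sequence whose
length is the Krull dimension of the ring. -/
def IsCohenMacaulayLocal (R : Type u) [CommRing R] [IsLocalRing R] : Prop :=
  ∃ rs : List R, (∀ x ∈ rs, x ∈ IsLocalRing.maximalIdeal R) ∧
    RingTheory.Sequence.IsRegular R rs ∧ (rs.length : WithBot ℕ∞) = ringKrullDim R

/-- Complete admissible rings: complete, one-dimensional, Noetherian, local, Cohen-Macaulay,
analytically reduced and residually rational rings with at least as many elements in the residue
field as there are minimal primes. -/
structure IsCompleteAdmissible (R : Type u) [CommRing R] [IsLocalRing R] : Prop where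
  noetherian : IsNoetherianRing R
  complete : IsAdicComplete (IsLocalRing.maximalIdeal R) R
  dim_one : ringKrullDim R = 1
  cohenMacaulay : IsCohenMacaulayLocal R
  analyticallyReduced : IsReduced (AdicCompletion (IsLocalRing.maximalIdeal R) R)
  /-- The residue fields of the integral closure of `R` in its total ring of fractions are all
  equal to the residue field of `R`. -/
  residuallyRational : ∀ n : Ideal (integralClosure R (FractionRing R)), n.IsMaximal →
    Function.Surjective
      (algebraMap R (integralClosure R (FractionRing R) ⧸ n))
  residueField_large : (minimalPrimes R).encard ≤ ENat.card (IsLocalRing.ResidueField R)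

end AdmissibleRing

end

/-! ### Complete one-dimensional local domains: finiteness and locality of the normalization. -/

section

/-! The length is computed by walking from `α⁰` to `γ` in unit steps parallel to the axes. Raising
the `i`-th coordinate of `α` by one shrinks `𝓘(α)` by length one if some `β ∈ E` has `β ≥ α` and `β
i = α i`, and by nothing otherwise: by residual rationality, two elements of the same value at `i`
are proportional over `R` modulo higher value (`length_quotient_truncation_update`).

Walk first along axis 0, then 1, then 2. The first leg counts the points of `E_0` in `[α⁰_0, γ_0)`,
i.e. `γ_0 - α⁰_0 - #𝓛(E_0)`. The second counts only those values in `E_1` attained with 0-th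
coordinate at least `γ_0`; the lost values correspond to the maximals of `E_{01}`
(`maximals_restrict_pair`). On the third leg let `C` be the set of values in `E_2` lost because they
are not attained with both other coordinates beyond `γ`, and let `A`, `B` be those not attained with
coordinate 0, respectively 1, beyond `γ`. Then `#A = #M(E_{02})`, `#B = #M(E_{12})`, and the
remaining point is `#RM + #A + #B = #AM + #C` (`ncard_relativeMaximals_add`).

This identity holds height by height. The slice of `E` at a height in `C` bounds a planar staircase
whose outer corners are the absolute maximals and whose inner corners are the relative maximals at
that height. A staircase bounded on both sides has one outer corner more than inner ones, and each
unbounded direction removes one outer corner from this balance (`ncard_innerCorners_add`).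

All of this uses only that `E` is closed under infima, has the exchange property, is bounded below
and contains a translated orthant (`IsGoodSet`). These properties come from algebra. By
Krull–Akizuki and completeness the normalization of each branch is finite; idempotents lift, so it
is local, hence a discrete valuation ring. As `R` is reduced, `K` is the product of the branch
fields, which makes the valuations independent. The size of the residue field gives infima, and
residual rationality gives exchange. -/

open AdicCompletion in
-- For finite `M` the completion of `M` is a quotient of the completion of `R` tensored with `M`,
-- and each scalar from the completion already comes from `R`.
theorem IsPrecomplete.of_finite {R : Type*} [CommRing R] (I : Ideal R) [IsPrecomplete I R]
    (M : Type*) [AddCommGroup M] [Module R M] [Module.Finite R M] : IsPrecomplete I M := by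
  rw [← of_surjective_iff]
  intro y
  obtain ⟨t, rfl⟩ := ofTensorProduct_surjective_of_finite I M y
  induction t with
  | zero => exact ⟨0, by simp⟩
  | tmul r x =>
    obtain ⟨r, rfl⟩ := of_surjective I R r
    refine ⟨r • x, ?_⟩
    rw [ofTensorProduct_tmul, map_smul]
    exact (algebraMap_smul (AdicCompletion I R) r (of I M x)).symm
  | add a b ha hb =>
    obtain ⟨a', ha⟩ := ha
    obtain ⟨b', hb⟩ := hb
    exact ⟨a' + b', by rw [map_add, map_add, ha, hb]⟩

/-- A separated module over a complete ring is finite if it is finite modulo the ideal of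
definition. -/
theorem Module.Finite.of_quotient_smul_top {R : Type*} [CommRing R] (I : Ideal R)
    [IsPrecomplete I R] (M : Type*) [AddCommGroup M] [Module R M] [IsHausdorff I M]
    [Module.Finite R (M ⧸ (I • ⊤ : Submodule R M))] : Module.Finite R M := by
  obtain ⟨n, f, hf⟩ := Module.Finite.exists_fin' R (M ⧸ (I • ⊤ : Submodule R M))
  obtain ⟨g, hg⟩ := Module.projective_lifting_property (I • ⊤ : Submodule R M).mkQ f
    (Submodule.mkQ_surjective _)
  have := IsPrecomplete.of_finite I (Fin n → R)
  exact Module.Finite.of_surjective g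
    (surjective_of_mkQ_comp_surjective (I := I) (by rw [hg]; exact hf))

/-- Compute the length of `M / xN` through `N` and through `xM`. Since `xM / xN ≅ M / N`, both sums
contain the finite length of `M / N`, which cancels. -/
theorem length_quotient_smul_eq {R M : Type*} [CommRing R] [AddCommGroup M] [Module R M] (x : R)
    (hx : Function.Injective (LinearMap.lsmul R M x)) (N : Submodule R M)
    (hN : Module.length R (M ⧸ N) ≠ ⊤) :
    Module.length R (N ⧸ LinearMap.range (LinearMap.lsmul R N x)) =
      Module.length R (M ⧸ LinearMap.range (LinearMap.lsmul R M x)) := by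
  let μ := LinearMap.lsmul R M x
  have h1 : N.map μ ≤ N := by
    rintro _ ⟨y, hy, rfl⟩; exact N.smul_mem _ hy
  have h2 : N.map μ ≤ LinearMap.range μ := LinearMap.map_le_range
  let f₁ : (N ⧸ LinearMap.range (LinearMap.lsmul R N x)) →ₗ[R] (M ⧸ N.map μ) :=
    Submodule.mapQ _ _ N.subtype (by
      rintro _ ⟨y, rfl⟩
      exact ⟨y, y.2, rfl⟩)
  let g₁ : (M ⧸ N.map μ) →ₗ[R] M ⧸ N := Submodule.factor h1
  let f₂ : (M ⧸ N) →ₗ[R] (M ⧸ N.map μ) := Submodule.mapQ _ _ μ (Submodule.le_comap_map _ _)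
  let g₂ : (M ⧸ N.map μ) →ₗ[R] M ⧸ LinearMap.range μ := Submodule.factor h2
  have e₁ := Module.length_eq_add_of_exact f₁ g₁ (by
      rw [← LinearMap.ker_eq_bot, LinearMap.ker_eq_bot']
      intro y
      induction y using Submodule.Quotient.induction_on with | _ y
      simp only [f₁, Submodule.mapQ_apply, Submodule.Quotient.mk_eq_zero]
      rintro ⟨z, hz, hzy⟩
      exact ⟨⟨z, hz⟩, Subtype.ext hzy⟩) (Submodule.factor_surjective h1) (by
      intro y
      induction y using Submodule.Quotient.induction_on with | _ y
      constructor
      · intro h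
        have h : y ∈ N := by simpa [g₁] using h
        exact ⟨Submodule.Quotient.mk ⟨y, h⟩, rfl⟩
      · rintro ⟨z, hz⟩
        induction z using Submodule.Quotient.induction_on with | _ z
        rw [← hz]
        simp [f₁, g₁])
  have e₂ := Module.length_eq_add_of_exact f₂ g₂ (by
      rw [← LinearMap.ker_eq_bot, LinearMap.ker_eq_bot']
      intro y
      induction y using Submodule.Quotient.induction_on with | _ y
      simp only [f₂, Submodule.mapQ_apply, Submodule.Quotient.mk_eq_zero]
      rintro ⟨z, hz, hzy⟩
      exact hx hzy ▸ hz) (Submodule.factor_surjective h2) (by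
      intro y
      induction y using Submodule.Quotient.induction_on with | _ y
      constructor
      · intro h
        obtain ⟨z, rfl⟩ : y ∈ LinearMap.range μ := by simpa [g₂] using h
        exact ⟨Submodule.Quotient.mk z, rfl⟩
      · rintro ⟨z, hz⟩
        induction z using Submodule.Quotient.induction_on with | _ z
        rw [← hz]
        simp [f₂, g₂])
  rw [e₁, add_comm] at e₂
  exact ENat.add_right_injective_of_ne_top hN e₂
-- A finitely generated submodule of greatest length is everything: adjoining one more element would
-- strictly increase the length.
theorem Module.finite_of_fg_length_le {R M : Type*} [CommRing R] [AddCommGroup M] [Module R M]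
    (n : ℕ) (h : ∀ N : Submodule R M, N.FG → Module.length R N ≤ n) : Module.Finite R M := by
  classical
  let S : Set ℕ := {k | ∃ N : Submodule R M, N.FG ∧ Module.length R N = k}
  have hS : S.Nonempty := ⟨0, ⊥, Submodule.fg_bot, by simp⟩
  have hb : BddAbove S := ⟨n, by
    rintro k ⟨N, hN, hk⟩
    have := h N hN
    rw [hk] at this
    exact_mod_cast this⟩
  obtain ⟨N, hN, hk⟩ := Nat.sSup_mem hS hb
  refine ⟨?_⟩
  convert hN
  rw [eq_comm, eq_top_iff]
  intro y _
  by_contra hy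
  have hF : (N ⊔ Submodule.span R {y}).FG := hN.sup (Submodule.fg_span_singleton y)
  have hlt : N < N ⊔ Submodule.span R {y} := by
    refine lt_of_le_of_ne le_sup_left fun he => hy ?_
    rw [he]
    exact Submodule.mem_sup_right (Submodule.mem_span_singleton_self y)
  obtain ⟨k, hk'⟩ := ENat.ne_top_iff_exists.1 (ne_top_of_le_ne_top (ENat.natCast_ne_top n) (h _ hF))
  have hle := le_csSup hb (show k ∈ S from ⟨_, hF, hk'.symm⟩)
  rw [Module.length_submodule] at hk hk'
  have := Order.height_strictMono hlt (by rw [hk]; exact ENat.natCast_lt_top _)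
  rw [hk, ← hk'] at this
  have : sSup S < k := by exact_mod_cast this
  omega

theorem isArtinianRing_quotient_span_singleton {A : Type*} [CommRing A] [IsDomain A]
    [IsNoetherianRing A] [Ring.DimensionLEOne A] {x : A} (hx : x ≠ 0) :
    IsArtinianRing (A ⧸ Ideal.span {x}) := by
  rw [isArtinianRing_iff_isNoetherianRing_krullDimLE_zero]
  refine ⟨inferInstance, .mk₀ fun I hI => ?_⟩
  have h : (I.comap (Ideal.Quotient.mk (Ideal.span {x}))).IsMaximal := by
    refine Ideal.IsPrime.isMaximal (hI.comap _) fun h0 => hx ?_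
    rw [← Ideal.mem_bot, ← h0, Ideal.mem_comap,
      Ideal.Quotient.eq_zero_iff_mem.2 (Ideal.mem_span_singleton_self x)]
    exact I.zero_mem
  have := Ideal.map_eq_top_or_isMaximal_of_surjective (Ideal.Quotient.mk (Ideal.span {x}))
    Ideal.Quotient.mk_surjective h
  rw [Ideal.map_comap_of_surjective _ Ideal.Quotient.mk_surjective I] at this
  exact this.resolve_left hI.ne_top

theorem length_quotient_ne_top {A : Type*} [CommRing A] [IsDomain A]
    [IsNoetherianRing A] [Ring.DimensionLEOne A] {J : Ideal A} (hJ : J ≠ ⊥) :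
    Module.length A (A ⧸ J) ≠ ⊤ := by
  obtain ⟨x, hxJ, hx⟩ := Submodule.exists_mem_ne_zero_of_ne_bot hJ
  have := isArtinianRing_quotient_span_singleton hx
  have h : Module.length A (A ⧸ Ideal.span {x}) ≠ ⊤ := by
    rw [Module.length_eq_of_surjective (R := A ⧸ Ideal.span {x}) (S := A)
      Ideal.Quotient.mk_surjective]
    exact Module.length_ne_top
  refine ne_top_of_le_ne_top h (Module.length_le_of_surjective (Submodule.factor
    ((Ideal.span_singleton_le_iff_mem J).2 hxJ)) (Submodule.factor_surjective _))

/-- A common denominator embeds `N` into `A` as an ideal. A nonzero ideal has finite colength, so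
`length_quotient_smul_eq` applies to it. -/
theorem length_quotient_smul_le_of_injective_fractions {A K : Type*} [CommRing A] [IsDomain A]
    [IsNoetherianRing A] [Ring.DimensionLEOne A] [Field K] [Algebra A K] [IsFractionRing A K]
    {N : Type*} [AddCommGroup N] [Module A N] [Module.Finite A N] (i : N →ₗ[A] K)
    (hi : Function.Injective i) {x : A} (hx : x ≠ 0) :
    Module.length A (N ⧸ LinearMap.range (LinearMap.lsmul A N x)) ≤
      Module.length A (A ⧸ LinearMap.range (LinearMap.lsmul A A x)) := by
  obtain ⟨b, hb, hbN⟩ := FractionalIdeal.isFractional_of_fg (S := nonZeroDivisors A)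
    (Module.Finite.fg_top.map i : (Submodule.map i ⊤).FG)
  have hb0 : b ≠ 0 := nonZeroDivisors.ne_zero hb
  have hinj : Function.Injective (Algebra.linearMap A K) := IsFractionRing.injective A K
  let g : N →ₗ[A] LinearMap.range (Algebra.linearMap A K) :=
    LinearMap.codRestrict _ (LinearMap.lsmul A K b ∘ₗ i) (fun y => hbN _ ⟨y, trivial, rfl⟩)
  have hg : Function.Injective g := fun y z hyz =>
    hi (smul_right_injective K hb0 (congrArg Subtype.val hyz))
  let f : N →ₗ[A] A := (LinearEquiv.ofInjective _ hinj).symm.toLinearMap ∘ₗ g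
  have hf : Function.Injective f := (LinearEquiv.ofInjective _ hinj).symm.injective.comp hg
  let e : N ≃ₗ[A] LinearMap.range f := LinearEquiv.ofInjective f hf
  have he : (LinearMap.range (LinearMap.lsmul A N x)).map e.toLinearMap =
      LinearMap.range (LinearMap.lsmul A (LinearMap.range f) x) := by
    ext y
    constructor
    · rintro ⟨_, ⟨z, rfl⟩, rfl⟩
      exact ⟨e z, (map_smul e x z).symm⟩
    · rintro ⟨z, rfl⟩
      exact ⟨_, ⟨e.symm z, rfl⟩, by simp⟩
  rw [(Submodule.Quotient.equiv _ _ e he).length_eq]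
  by_cases h0 : LinearMap.range f = ⊥
  · have : Subsingleton (LinearMap.range f) := by rw [h0]; infer_instance
    simp [Module.length_eq_zero]
  · exact (length_quotient_smul_eq x (smul_right_injective A hx) _ (length_quotient_ne_top h0)).le

/-- The Krull–Akizuki theorem: a rank one torsion-free module over a one-dimensional Noetherian
domain is finite modulo every nonzero element. -/
theorem finite_quotient_smul_of_injective_fractions {A K : Type*} [CommRing A] [IsDomain A]
    [IsNoetherianRing A] [Ring.DimensionLEOne A] [Field K] [Algebra A K] [IsFractionRing A K]
    {N : Type*} [AddCommGroup N] [Module A N] (i : N →ₗ[A] K)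
    (hi : Function.Injective i) {x : A} (hx : x ≠ 0) :
    Module.Finite A (N ⧸ LinearMap.range (LinearMap.lsmul A N x)) := by
  have hrange : LinearMap.range (LinearMap.lsmul A A x) ≠ ⊥ := by
    intro h
    have : x • (1 : A) ∈ LinearMap.range (LinearMap.lsmul A A x) := ⟨1, rfl⟩
    rw [h] at this
    simp [hx] at this
  obtain ⟨n, hn⟩ := ENat.ne_top_iff_exists.1 (length_quotient_ne_top hrange)
  -- The bound `n` is the length of `A / xA`. A finitely generated `F` inside `N / xN` is the image
  -- of a finitely generated `G` inside `N`, hence a quotient of `G / xG`, which has length at most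
  -- `n`.
  refine Module.finite_of_fg_length_le n fun F hF => ?_
  obtain ⟨s, hs⟩ := hF
  obtain ⟨G, hG, hGF⟩ : ∃ G : Submodule A N, G.FG ∧
      G.map (LinearMap.range (LinearMap.lsmul A N x)).mkQ = F := by
    classical
    refine ⟨Submodule.span A (s.image Quotient.out), ⟨_, rfl⟩, ?_⟩
    rw [Submodule.map_span, ← hs]
    congr 1
    ext y
    simp
  have hGF' : ∀ y ∈ G, (LinearMap.range (LinearMap.lsmul A N x)).mkQ y ∈ F := fun y hy =>
    hGF ▸ Submodule.mem_map_of_mem hy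
  let φ : G →ₗ[A] F := LinearMap.restrict _ hGF'
  have hφ : Function.Surjective φ := by
    rintro ⟨y, hy⟩
    rw [← hGF] at hy
    obtain ⟨z, hz, rfl⟩ := hy
    exact ⟨⟨z, hz⟩, rfl⟩
  have hker : LinearMap.range (LinearMap.lsmul A G x) ≤ LinearMap.ker φ := by
    rintro _ ⟨y, rfl⟩
    rw [LinearMap.mem_ker]
    refine Subtype.ext ?_
    exact (Submodule.Quotient.mk_eq_zero _).2 ⟨y, rfl⟩
  have : Module.Finite A G := Module.Finite.iff_fg.2 hG
  rw [hn]
  exact (Module.length_le_of_surjective (Submodule.liftQ _ φ hker) (fun y => by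
    obtain ⟨z, rfl⟩ := hφ y
    exact ⟨Submodule.Quotient.mk z, rfl⟩)).trans
    (length_quotient_smul_le_of_injective_fractions (i ∘ₗ G.subtype)
      (hi.comp Subtype.val_injective) hx)

open IsLocalRing

theorem exists_maximalIdeal_pow_le_span_singleton {A : Type*} [CommRing A] [IsLocalRing A]
    [IsNoetherianRing A] [Ring.DimensionLEOne A] {a : A} (ha : a ≠ 0) :
    ∃ n, maximalIdeal A ^ n ≤ Ideal.span {a} := by
  refine Ideal.exists_pow_le_of_le_radical_of_fg ?_ (IsNoetherian.noetherian _)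
  rw [Ideal.radical_eq_sInf]
  refine le_sInf fun P ⟨hP, hPp⟩ => ?_
  have : P.IsMaximal := hPp.isMaximal fun h => ha (by
    rw [← Ideal.mem_bot, ← h]; exact hP (Ideal.mem_span_singleton_self a))
  exact (eq_maximalIdeal this).ge

section
variable {A V : Type*} [CommRing A] [IsLocalRing A]
    [IsNoetherianRing A] [Ring.DimensionLEOne A] [CommRing V] [IsDomain V] [Algebra A V]
    [Algebra.IsIntegral A V] [FaithfulSMul A V]

/-- A nonzero `v` in every `𝔪ⁿV` would be divisible by all powers of some nonzero `x ∈ 𝔪`. By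
integrality `v` divides a nonzero `a ∈ A`, and `a` divides a power `x ^ M`; so `x ^ (M + 1)` divides
`x ^ M` and `x` becomes a unit in `V`, hence in `A`. -/
theorem isHausdorff_of_isIntegral (hA : ¬ IsField A) : IsHausdorff (maximalIdeal A) V := by
  obtain ⟨x, hxm, hx0⟩ := Submodule.exists_mem_ne_zero_of_ne_bot
    (fun h => hA (isField_iff_maximalIdeal_eq.2 h))
  have hinj := FaithfulSMul.algebraMap_injective A V
  refine ⟨fun v hv => ?_⟩
  by_contra hv0
  obtain ⟨N, hN⟩ := exists_maximalIdeal_pow_le_span_singleton hx0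
  have hdiv : ∀ n, ∃ w : V, v = algebraMap A V x ^ n * w := by
    intro n
    have h1 := SModEq.zero.1 (hv (N * n))
    have h2 : maximalIdeal A ^ (N * n) ≤ Ideal.span {x ^ n} := by
      rw [pow_mul, ← Ideal.span_singleton_pow]
      exact Ideal.pow_right_mono hN n
    have h3 := Submodule.smul_mono_left (N := (⊤ : Submodule A V)) h2 h1
    rw [Submodule.ideal_span_singleton_smul] at h3
    obtain ⟨w, -, hw⟩ := h3
    exact ⟨w, by rw [← hw, ← map_pow, ← Algebra.smul_def]; rfl⟩
  obtain ⟨a, ha, ha0⟩ := Submodule.exists_mem_ne_zero_of_ne_bot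
    (Ideal.comap_ne_bot_of_integral_mem (R := A) hv0 (Ideal.mem_span_singleton_self v)
      (Algebra.IsIntegral.isIntegral v))
  obtain ⟨u, hu⟩ := Ideal.mem_span_singleton'.1 (Ideal.mem_comap.1 ha)
  obtain ⟨M, hM⟩ := exists_maximalIdeal_pow_le_span_singleton ha0
  obtain ⟨c, hc⟩ := Ideal.mem_span_singleton'.1 (hM (Ideal.pow_mem_pow hxm M))
  obtain ⟨w, hw⟩ := hdiv (M + 1)
  have hx0' : algebraMap A V x ≠ 0 := by rwa [Ne, map_eq_zero_iff _ hinj]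
  have h1 : algebraMap A V x * (algebraMap A V c * u * w) = 1 := by
    have := congrArg (algebraMap A V) hc
    rw [map_mul, ← hu, map_pow] at this
    refine mul_left_cancel₀ (pow_ne_zero M hx0') ?_
    calc algebraMap A V x ^ M * (algebraMap A V x * (algebraMap A V c * u * w))
        = algebraMap A V c * (u * (algebraMap A V x ^ (M + 1) * w)) := by ring
      _ = algebraMap A V x ^ M * 1 := by rw [← hw, this, mul_one]
  have h2 : IsUnit (algebraMap A V x) := IsUnit.of_mul_eq_one _ h1
  exact (mem_maximalIdeal _).1 hxm (isUnit_of_map_unit (algebraMap A V) _ h2)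

end

/-- The chain of powers of `v` stabilizes. The point is that `(v * y) ^ (n + 1)` is then an
idempotent generating the same ideal as `v ^ (n + 1)`. -/
theorem exists_pow_mul_eq_of_isArtinianRing {Q : Type*} [CommRing Q] [IsArtinianRing Q] (v : Q) :
    ∃ (n : ℕ) (y : Q), v ^ (n + 1) * (v * y) ^ (n + 1) = v ^ (n + 1) := by
  obtain ⟨n, y, hy⟩ := IsArtinian.exists_pow_succ_smul_dvd v (1 : Q)
  have hy : v ^ n * (v * y) = v ^ n := by
    simp only [smul_eq_mul, mul_one, Nat.succ_eq_add_one] at hy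
    linear_combination hy
  refine ⟨n, y, ?_⟩
  have h : ∀ k : ℕ, v ^ n * (v * y) ^ k = v ^ n := by
    intro k
    induction k with
    | zero => simp
    | succ k ih => rw [pow_succ, ← mul_assoc, ih, hy]
  rw [pow_succ, mul_right_comm, h]

theorem IsAdicComplete.of_finite {A : Type*} [CommRing A] [IsLocalRing A] [IsNoetherianRing A]
    [IsAdicComplete (maximalIdeal A) A] (M : Type*) [AddCommGroup M] [Module A M]
    [Module.Finite A M] : IsAdicComplete (maximalIdeal A) M :=
  { IsPrecomplete.of_finite (maximalIdeal A) M with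
    toIsHausdorff := inferInstance }

-- Hensel's lemma for `X ^ 2 - X`: modulo `I` the derivative `2e - 1` squares to `1`, so it is a
-- unit.
open Polynomial in
theorem HenselianRing.exists_isIdempotentElem {V : Type*} [CommRing V] (I : Ideal V)
    [HenselianRing V I] (e : V) (he : e * e - e ∈ I) : ∃ a : V, a * a = a ∧ a - e ∈ I := by
  have hm : (X ^ 2 - X : V[X]).Monic := by
    nontriviality V
    exact (monic_X_pow 2).sub_of_left (by rw [degree_X_pow, degree_X]; norm_num)
  obtain ⟨a, ha, hae⟩ := HenselianRing.is_henselian (I := I) (X ^ 2 - X : V[X]) hm e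
    (by simpa [sq] using he) (by
      have h : Ideal.Quotient.mk I e * Ideal.Quotient.mk I e = Ideal.Quotient.mk I e := by
        rw [← map_mul]; exact Ideal.Quotient.eq.2 he
      refine IsUnit.of_mul_eq_one (2 * Ideal.Quotient.mk I e - 1) ?_
      have h2 : eval e (derivative (X ^ 2 - X : V[X])) = 2 * e - 1 := by
        simp [one_add_one_eq_two]
      rw [h2, map_sub, map_mul, map_one, map_ofNat]
      linear_combination 4 * h)
  refine ⟨a, ?_, hae⟩
  simpa [sq, sub_eq_zero] using ha

/-- If `v` lies in one maximal ideal `P` but not in another, `Q`, the Artinian ring `V / 𝔪V` has an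
idempotent that vanishes modulo `P` but not modulo `Q`. It lifts to `V`, where a domain allows only
`0` and `1`. -/
theorem isLocalRing_of_finite_of_isAdicComplete (A : Type*) {V : Type*} [CommRing A] [IsLocalRing A]
    [IsNoetherianRing A] [IsAdicComplete (maximalIdeal A) A] [CommRing V] [IsDomain V]
    [Algebra A V] [Module.Finite A V] : IsLocalRing V := by
  set I := (maximalIdeal A).map (algebraMap A V)
  have : IsAdicComplete I V :=
    (IsAdicComplete.map_algebraMap_iff _ _).2 (IsAdicComplete.of_finite V)
  have hI : I ≤ Ideal.jacobson ⊥ := IsAdicComplete.le_jacobson_bot I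
  have : IsArtinianRing (V ⧸ I) := by
    have : Module.Finite (A ⧸ maximalIdeal A) (V ⧸ I) :=
      Module.Finite.of_restrictScalars_finite A _ _
    have : IsArtinianRing (A ⧸ maximalIdeal A) :=
      inferInstanceAs (IsArtinianRing (ResidueField A))
    exact IsArtinianRing.of_finite (A ⧸ maximalIdeal A) (V ⧸ I)
  have huniq : ∀ P Q : Ideal V, P.IsMaximal → Q.IsMaximal → P ≤ Q := by
    intro P Q hP hQ v hvP
    by_contra hvQ
    obtain ⟨n, y, hy⟩ := exists_pow_mul_eq_of_isArtinianRing (Ideal.Quotient.mk I v)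
    obtain ⟨y, rfl⟩ := Ideal.Quotient.mk_surjective y
    have hIP : I ≤ P := hI.trans (sInf_le ⟨bot_le, hP⟩)
    have hIQ : I ≤ Q := hI.trans (sInf_le ⟨bot_le, hQ⟩)
    have hy' : v ^ (n + 1) * (v * y) ^ (n + 1) - v ^ (n + 1) ∈ I := by
      rw [← Ideal.Quotient.eq]
      simpa using hy
    obtain ⟨a, ha, hae⟩ := HenselianRing.exists_isIdempotentElem I ((v * y) ^ (n + 1)) (by
      have := I.mul_mem_left (y ^ (n + 1)) hy'
      convert this using 1
      ring)
    have hPp := hP.isPrime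
    have hQp := hQ.isPrime
    -- A lift equal to `0` puts a power of `v` into `Q`; a lift equal to `1` puts `1` into `P`.
    rcases mul_eq_zero.1 (show a * (a - 1) = 0 by rw [mul_sub, ha, mul_one, sub_self]) with h | h
    · rw [h, zero_sub, neg_mem_iff] at hae
      refine hvQ (hQp.mem_of_pow_mem (n + 1) ?_)
      have := Q.sub_mem (Q.mul_mem_left (v ^ (n + 1)) (hIQ hae)) (hIQ hy')
      rwa [sub_sub_cancel] at this
    · rw [sub_eq_zero.1 h] at hae
      refine hP.ne_top ((Ideal.eq_top_iff_one P).2 ?_)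
      have := P.add_mem (hIP hae) (P.pow_mem_of_mem (P.mul_mem_right y hvP) (n + 1) n.succ_pos)
      rwa [sub_add_cancel] at this
  obtain ⟨P, hP⟩ := Ideal.exists_maximal V
  exact .of_unique_max_ideal ⟨P, hP, fun Q hQ => le_antisymm (huniq Q P hQ hP) (huniq P Q hP hQ)⟩

/-- Krull–Akizuki makes the closure finite modulo a nonzero `x ∈ 𝔪`; being separated over a complete
ring, it is then finite itself. -/
theorem finite_integralClosure_of_isAdicComplete {A K : Type*} [CommRing A] [IsDomain A]
    [IsLocalRing A] [IsNoetherianRing A] [Ring.DimensionLEOne A] [Field K] [Algebra A K]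
    [IsFractionRing A K] [IsAdicComplete (maximalIdeal A) A] (hA : ¬ IsField A) :
    Module.Finite A (integralClosure A K) := by
  obtain ⟨x, hxm, hx0⟩ := Submodule.exists_mem_ne_zero_of_ne_bot
    (fun h => hA (isField_iff_maximalIdeal_eq.2 h))
  have := isHausdorff_of_isIntegral (V := integralClosure A K) hA
  have h := finite_quotient_smul_of_injective_fractions (A := A) (K := K)
    (integralClosure A K).val.toLinearMap Subtype.val_injective hx0
  have hle : LinearMap.range (LinearMap.lsmul A (integralClosure A K) x) ≤
      maximalIdeal A • (⊤ : Submodule A (integralClosure A K)) := by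
    rintro _ ⟨y, rfl⟩
    exact Submodule.smul_mem_smul hxm trivial
  have := Module.Finite.of_surjective (Submodule.factor hle) (Submodule.factor_surjective hle)
  exact Module.Finite.of_quotient_smul_top (maximalIdeal A) _

theorem isDiscreteValuationRing_integralClosure_of_isAdicComplete {A K : Type*} [CommRing A]
    [IsDomain A] [IsLocalRing A] [IsNoetherianRing A] [Ring.DimensionLEOne A] [Field K]
    [Algebra A K] [IsFractionRing A K] [IsAdicComplete (maximalIdeal A) A] (hA : ¬ IsField A) :
    IsDiscreteValuationRing (integralClosure A K) := by
  have := finite_integralClosure_of_isAdicComplete (A := A) (K := K) hA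
  have : IsLocalRing (integralClosure A K) := isLocalRing_of_finite_of_isAdicComplete A
  have : IsNoetherianRing (integralClosure A K) := IsNoetherianRing.of_finite A _
  have : IsIntegrallyClosed (integralClosure A K) :=
    integralClosure.isIntegrallyClosedOfFiniteExtension K
  have : IsDedekindDomain (integralClosure A K) := { }
  have hf : ¬ IsField (integralClosure A K) := fun h => hA (isField_of_isIntegral_of_isField
    (FaithfulSMul.algebraMap_injective A (integralClosure A K)) h)
  exact ((IsDiscreteValuationRing.TFAE _ hf).out 0 2).2 this

end

/-! ### Branches of a complete admissible ring, and its total ring of fractions as a product of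
fields. -/

section

open scoped nonZeroDivisors
open IsLocalRing
namespace AdmissibleRing
universe u
variable {R : Type u} [CommRing R] [IsLocalRing R]

namespace IsCompleteAdmissible

theorem isReduced (hR : IsCompleteAdmissible R) : IsReduced R := by
  have := hR.complete
  have := hR.analyticallyReduced
  exact isReduced_of_injective (algebraMap R (AdicCompletion (maximalIdeal R) R))
    (AdicCompletion.of_injective (maximalIdeal R) R)

/-- In dimension one the regular sequence given by the Cohen–Macaulay property is a single regular
element. -/
theorem exists_mem_nonZeroDivisors (hR : IsCompleteAdmissible R) :
    ∃ x ∈ maximalIdeal R, x ∈ R⁰ := by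
  obtain ⟨rs, hm, hreg, hlen⟩ := hR.cohenMacaulay
  rw [hR.dim_one] at hlen
  obtain ⟨x, rfl⟩ := List.length_eq_one_iff.1 (show rs.length = 1 by exact_mod_cast hlen)
  refine ⟨x, hm x (by simp), ?_⟩
  have := hreg.toIsWeaklyRegular
  rw [RingTheory.Sequence.isWeaklyRegular_singleton_iff] at this
  rw [mem_nonZeroDivisors_iff_right]
  intro z hz
  exact this (by simpa [mul_comm] using hz)

variable (P : minimalPrimes R)

theorem branch_isLocalRing : IsLocalRing (Branch P) :=
  IsLocalRing.of_surjective' (Ideal.Quotient.mk P.1) Ideal.Quotient.mk_surjective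

attribute [local instance] branch_isLocalRing

theorem maximalIdeal_branch :
    (maximalIdeal R).map (Ideal.Quotient.mk P.1) = maximalIdeal (Branch P) :=
  map_maximalIdeal_of_surjective _ Ideal.Quotient.mk_surjective

theorem branch_isNoetherianRing (hR : IsCompleteAdmissible R) : IsNoetherianRing (Branch P) := by
  have := hR.noetherian
  infer_instance

theorem branch_isAdicComplete (hR : IsCompleteAdmissible R) :
    IsAdicComplete (maximalIdeal (Branch P)) (Branch P) := by
  have := hR.noetherian
  have := hR.complete
  rw [← maximalIdeal_branch]
  exact (IsAdicComplete.map_algebraMap_iff _ _).2 (IsAdicComplete.of_finite (Branch P))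

theorem branch_dimensionLEOne (hR : IsCompleteAdmissible R) : Ring.DimensionLEOne (Branch P) := by
  have h1 : Ring.KrullDimLE 1 R := Ring.krullDimLE_iff.2 hR.dim_one.le
  refine ⟨fun {q} hq0 hq => ?_⟩
  have hle : P.1 ≤ q.comap (Ideal.Quotient.mk P.1) := fun y hy => by
    rw [Ideal.mem_comap, Ideal.Quotient.eq_zero_iff_mem.2 hy]
    exact q.zero_mem
  rcases Ring.krullDimLE_one_iff.1 h1 _ (hq.comap (Ideal.Quotient.mk P.1)) with h | h
  · refine absurd ?_ hq0
    have h2 := h.2 P.2.1 hle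
    rw [← Ideal.map_comap_of_surjective _ Ideal.Quotient.mk_surjective q, eq_bot_iff,
      Ideal.map_le_iff_le_comap, ← RingHom.ker_eq_comap_bot, Ideal.mk_ker]
    exact h2
  · have := Ideal.map_eq_top_or_isMaximal_of_surjective (Ideal.Quotient.mk P.1)
      Ideal.Quotient.mk_surjective h
    rw [Ideal.map_comap_of_surjective _ Ideal.Quotient.mk_surjective q] at this
    exact this.resolve_left hq.ne_top

theorem branch_not_isField (hR : IsCompleteAdmissible R) : ¬ IsField (Branch P) := by
  obtain ⟨x, hxm, hx⟩ := hR.exists_mem_nonZeroDivisors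
  intro h
  have h1 : Ideal.Quotient.mk P.1 x ≠ 0 :=
    nonZeroDivisors.ne_zero (nonZeroDivisors_le_comap_branch P hx)
  have h2 : Ideal.Quotient.mk P.1 x ∈ maximalIdeal (Branch P) := by
    rw [← maximalIdeal_branch]
    exact Ideal.mem_map_of_mem _ hxm
  rw [isField_iff_maximalIdeal_eq.1 h] at h2
  exact h1 h2

theorem finite_branchNormalization (hR : IsCompleteAdmissible R) :
    Module.Finite (Branch P) (BranchNormalization P) :=
  have := branch_isNoetherianRing P hR
  have := branch_isAdicComplete P hR
  have := branch_dimensionLEOne P hR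
  finite_integralClosure_of_isAdicComplete (branch_not_isField P hR)

theorem isDiscreteValuationRing_branchNormalization (hR : IsCompleteAdmissible R) :
    IsDiscreteValuationRing (BranchNormalization P) :=
  have := branch_isNoetherianRing P hR
  have := branch_isAdicComplete P hR
  have := branch_dimensionLEOne P hR
  isDiscreteValuationRing_integralClosure_of_isAdicComplete (branch_not_isField P hR)

end IsCompleteAdmissible

section DVR

variable (A K : Type*) [CommRing A] [IsDomain A] [IsDiscreteValuationRing A] [Field K]
  [Algebra A K] [IsFractionRing A K]

theorem dvrVal_eq_top_iff (x : K) : dvrVal A K x = ⊤ ↔ x = 0 := by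
  by_cases h : x = 0 <;> simp [dvrVal, h]

theorem dvrVal_mul (x y : K) : dvrVal A K (x * y) = dvrVal A K x + dvrVal A K y := by
  by_cases hx : x = 0
  · simp [dvrVal, hx]
  by_cases hy : y = 0
  · simp [dvrVal, hy]
  rw [dvrVal, dvrVal, dvrVal, if_neg hx, if_neg hy, if_neg (mul_ne_zero hx hy), map_mul,
    WithZero.log_mul ((Valuation.ne_zero_iff _).2 hx) ((Valuation.ne_zero_iff _).2 hy),
    ← WithTop.coe_add]
  congr 1
  ring

theorem zero_le_dvrVal_iff (x : K) : 0 ≤ dvrVal A K x ↔ ∃ a, algebraMap A K a = x := by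
  have h := le_dvrVal_iff A K 0 x
  rw [neg_zero, WithZero.exp_zero] at h
  rw [← WithTop.coe_zero, h]
  constructor
  · exact IsDiscreteValuationRing.exists_lift_of_le_one
  · rintro ⟨a, rfl⟩
    exact (IsDiscreteValuationRing.maximalIdeal A).valuation_le_one a

theorem exists_dvrVal_eq (n : WithTop ℤ) : ∃ x, dvrVal A K x = n := by
  induction n with
  | top => exact ⟨0, by simp [dvrVal_eq_top_iff]⟩
  | coe n =>
    obtain ⟨π, hπ⟩ := (IsDiscreteValuationRing.maximalIdeal A).valuation_exists_uniformizer K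
    have h0 : π ≠ 0 := by
      rintro rfl
      rw [map_zero] at hπ
      exact WithZero.exp_ne_zero hπ.symm
    refine ⟨π ^ n, ?_⟩
    rw [dvrVal, if_neg (zpow_ne_zero n h0), map_zpow₀, hπ, WithZero.log_zpow]
    simp

theorem one_le_dvrVal_algebraMap_iff (a : A) :
    1 ≤ dvrVal A K (algebraMap A K a) ↔ a ∈ maximalIdeal A := by
  rw [show (1 : WithTop ℤ) = ((1 : ℤ) : WithTop ℤ) from rfl, le_dvrVal_iff,
    IsDedekindDomain.HeightOneSpectrum.valuation_of_algebraMap]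
  have h := (IsDiscreteValuationRing.maximalIdeal A).intValuation_le_pow_iff_mem a 1
  rw [pow_one] at h
  exact h

end DVR

section TotalFractions

variable {R : Type u} [CommRing R]

theorem projBranch_algebraMap (P : minimalPrimes R) (r : R) :
    projBranch P (algebraMap R (FractionRing R) r) =
      algebraMap (Branch P) (BranchField P) (Ideal.Quotient.mk P.1 r) :=
  IsLocalization.map_eq _ _

theorem projBranch_smul (P : minimalPrimes R) (r : R) (h : FractionRing R) :
    projBranch P (r • h) = algebraMap (Branch P) (BranchField P) (Ideal.Quotient.mk P.1 r) *
      projBranch P h := by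
  rw [Algebra.smul_def, map_mul, projBranch_algebraMap]

theorem projBranch_algebraMap_eq_zero_iff (P : minimalPrimes R) (r : R) :
    projBranch P (algebraMap R (FractionRing R) r) = 0 ↔ r ∈ P.1 := by
  rw [projBranch_algebraMap, map_eq_zero_iff _ (IsFractionRing.injective _ _),
    Ideal.Quotient.eq_zero_iff_mem]

theorem eq_zero_of_mem_minimalPrimes [IsReduced R] {r : R} (h : ∀ P : minimalPrimes R, r ∈ P.1) :
    r = 0 := by
  have : r ∈ sInf (minimalPrimes R) := Ideal.mem_sInf.2 fun {P} hP => h ⟨P, hP⟩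
  rw [minimalPrimes, Ideal.sInf_minimalPrimes] at this
  obtain ⟨n, hn⟩ := this
  exact eq_zero_of_pow_eq_zero hn

/-- The minimal primes of a reduced ring intersect in zero, so `K` embeds into the product of the
branch fields. With `exists_projBranch_eq` it is that product. -/
theorem eq_zero_of_projBranch_eq_zero [IsReduced R] {h : FractionRing R}
    (hh : ∀ P : minimalPrimes R, projBranch P h = 0) : h = 0 := by
  obtain ⟨a, s, rfl⟩ := IsLocalization.exists_mk'_eq R⁰ h
  have : a = 0 := eq_zero_of_mem_minimalPrimes fun P => by
    rw [← projBranch_algebraMap_eq_zero_iff, ← IsLocalization.mk'_spec (FractionRing R) a s,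
      map_mul, hh, zero_mul]
  rw [this, IsLocalization.mk'_zero]

theorem mem_nonZeroDivisors_of_notMem_minimalPrimes [IsReduced R] {s : R}
    (h : ∀ P : minimalPrimes R, s ∉ P.1) : s ∈ R⁰ := by
  rw [mem_nonZeroDivisors_iff_right]
  intro z hz
  refine eq_zero_of_mem_minimalPrimes fun P => ?_
  have hP : P.1.IsPrime := P.2.1.1
  exact (hP.mem_or_mem (show z * s ∈ P.1 by rw [hz]; exact P.1.zero_mem)).resolve_right (h P)

theorem exists_notMem_and_mem_minimalPrimes [Finite (minimalPrimes R)] (P : minimalPrimes R) :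
    ∃ r, r ∉ P.1 ∧ ∀ Q : minimalPrimes R, Q ≠ P → r ∈ Q.1 := by
  classical
  have := Fintype.ofFinite (minimalPrimes R)
  by_contra! hcon
  have hP : P.1.IsPrime := P.2.1.1
  have hle : (Finset.univ.erase P).inf (fun Q : minimalPrimes R => Q.1) ≤ P.1 := by
    intro r hr
    by_contra hrP
    obtain ⟨Q, hQ, hrQ⟩ := hcon r hrP
    exact hrQ ((Finset.inf_le (f := fun Q : minimalPrimes R => Q.1)
      (Finset.mem_erase.2 ⟨hQ, Finset.mem_univ Q⟩)) hr)
  obtain ⟨Q, hQ, hQP⟩ := (hP.inf_le' ).1 hle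
  exact (Finset.mem_erase.1 hQ).1 (Subtype.ext (le_antisymm hQP (P.2.2 Q.2.1 hQP)))

theorem exists_projBranch_eq_single [IsReduced R] [Finite (minimalPrimes R)] (P : minimalPrimes R)
    (x : BranchField P) : ∃ h : FractionRing R, projBranch P h = x ∧
      ∀ Q : minimalPrimes R, Q ≠ P → projBranch Q h = 0 := by
  classical
  have := Fintype.ofFinite (minimalPrimes R)
  choose r hr hr' using exists_notMem_and_mem_minimalPrimes (R := R)
  obtain ⟨a, b, rfl⟩ := IsLocalization.exists_mk'_eq (Branch P)⁰ x
  obtain ⟨a, rfl⟩ := Ideal.Quotient.mk_surjective a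
  obtain ⟨b, hb⟩ := b
  obtain ⟨b, rfl⟩ := Ideal.Quotient.mk_surjective b
  have hbP : b ∉ P.1 := fun h => nonZeroDivisors.ne_zero hb (Ideal.Quotient.eq_zero_iff_mem.2 h)
  -- The denominator is `b * r P` modulo `P` and `r Q` modulo every other minimal prime `Q`. It
  -- avoids all minimal primes, so it is regular, and `a * r P / s` is `a / b` on branch `P` and `0`
  -- elsewhere.
  set s := b * r P + ∑ Q ∈ Finset.univ.erase P, r Q with hs
  have hP : P.1.IsPrime := P.2.1.1
  have hsum : ∑ Q ∈ Finset.univ.erase P, r Q ∈ P.1 :=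
    Ideal.sum_mem _ fun Q hQ => hr' Q P (Finset.mem_erase.1 hQ).1.symm
  have hsreg : s ∈ R⁰ := by
    refine mem_nonZeroDivisors_of_notMem_minimalPrimes fun Q hQ => ?_
    have hQp : Q.1.IsPrime := Q.2.1.1
    by_cases hQP : Q = P
    · subst hQP
      exact (hQp.mul_notMem hbP (hr Q)) ((Ideal.add_mem_iff_left _ hsum).1 hQ)
    · rw [hs, ← Finset.add_sum_erase _ _ (Finset.mem_erase.2 ⟨hQP, Finset.mem_univ Q⟩),
        Ideal.add_mem_iff_right _ (Ideal.mul_mem_left _ _ (hr' P Q hQP)),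
        Ideal.add_mem_iff_left _ (Ideal.sum_mem _ fun S hS =>
          hr' S Q (Finset.mem_erase.1 hS).1.symm)] at hQ
      exact hr Q hQ
  have hkey : ∀ Q : minimalPrimes R, projBranch Q
      (IsLocalization.mk' (FractionRing R) (a * r P) (⟨s, hsreg⟩ : R⁰)) *
        algebraMap (Branch Q) (BranchField Q) (Ideal.Quotient.mk Q.1 s) =
      algebraMap (Branch Q) (BranchField Q) (Ideal.Quotient.mk Q.1 (a * r P)) := fun Q => by
    rw [← projBranch_algebraMap, ← projBranch_algebraMap, ← map_mul, IsLocalization.mk'_spec]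
  refine ⟨IsLocalization.mk' _ (a * r P) (⟨s, hsreg⟩ : R⁰), ?_, fun Q hQ => ?_⟩
  · have h := hkey P
    have hs' : Ideal.Quotient.mk P.1 s = Ideal.Quotient.mk P.1 b * Ideal.Quotient.mk P.1 (r P) := by
      rw [hs, map_add, map_mul, Ideal.Quotient.eq_zero_iff_mem.2 hsum, add_zero]
    rw [hs', map_mul, map_mul, map_mul, ← mul_assoc] at h
    have hr0 : algebraMap (Branch P) (BranchField P) (Ideal.Quotient.mk P.1 (r P)) ≠ 0 := by
      rw [← projBranch_algebraMap, Ne, projBranch_algebraMap_eq_zero_iff]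
      exact hr P
    exact IsLocalization.eq_mk'_iff_mul_eq.2 (mul_right_cancel₀ hr0 h)
  · have h := hkey Q
    rw [← projBranch_algebraMap, ← projBranch_algebraMap,
      (projBranch_algebraMap_eq_zero_iff Q (a * r P)).2 (Ideal.mul_mem_left _ _ (hr' P Q hQ))] at h
    refine (mul_eq_zero.1 h).resolve_right ?_
    rw [projBranch_algebraMap_eq_zero_iff]
    exact fun h => Set.disjoint_left.mp (Ideal.disjoint_nonZeroDivisors_of_mem_minimalPrimes Q.2)
      h hsreg

theorem exists_projBranch_eq [IsReduced R] [Finite (minimalPrimes R)]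
    (x : ∀ P : minimalPrimes R, BranchField P) :
    ∃ h : FractionRing R, ∀ P, projBranch P h = x P := by
  classical
  have := Fintype.ofFinite (minimalPrimes R)
  choose h hh hh' using fun P => exists_projBranch_eq_single P (x P)
  refine ⟨∑ P, h P, fun P => ?_⟩
  rw [map_sum, Finset.sum_eq_single P (fun Q _ hQ => hh' Q P hQ.symm) (by simp), hh]

theorem mem_nonZeroDivisors_fractionRing_iff [IsReduced R] [Finite (minimalPrimes R)]
    (h : FractionRing R) :
    h ∈ (FractionRing R)⁰ ↔ ∀ P : minimalPrimes R, projBranch P h ≠ 0 := by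
  rw [mem_nonZeroDivisors_iff_right]
  constructor
  · intro hreg P hP
    obtain ⟨z, hz, hz'⟩ := exists_projBranch_eq_single P (1 : BranchField P)
    have := hreg z (eq_zero_of_projBranch_eq_zero fun Q => by
      rw [map_mul]
      by_cases hQ : Q = P
      · subst hQ; rw [hP, mul_zero]
      · rw [hz' Q hQ, zero_mul])
    rw [this, map_zero] at hz
    exact zero_ne_one hz
  · intro hP z hz
    refine eq_zero_of_projBranch_eq_zero fun P => (mul_eq_zero.1 ?_).resolve_right (hP P)
    rw [← map_mul, hz, map_zero]

end TotalFractions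
end AdmissibleRing

end

/-! ### The branch valuations as an abstract valuation family, and bounds for fractional ideals. -/

section

open scoped nonZeroDivisors
open IsLocalRing
namespace AdmissibleRing
universe u

/-- A family `w` of functions on an `R`-module with the formal properties of a family of
independent, residually rational discrete valuations of a ring containing the local ring `R`. -/
structure IsValuationFamily (R : Type*) {K ι : Type*} [CommRing R] [IsLocalRing R]
    [AddCommGroup K] [Module R K] (w : ι → K → WithTop ℤ) : Prop where
  le_add : ∀ i (n : ℤ) x y, (n : WithTop ℤ) ≤ w i x → (n : WithTop ℤ) ≤ w i y →
    (n : WithTop ℤ) ≤ w i (x + y)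
  le_smul : ∀ i (n : ℤ) (r : R) x, (n : WithTop ℤ) ≤ w i x → (n : WithTop ℤ) ≤ w i (r • x)
  le_smul_of_mem : ∀ i (n : ℤ) (r : R) x, r ∈ maximalIdeal R → (n : WithTop ℤ) ≤ w i x →
    ((n + 1 : ℤ) : WithTop ℤ) ≤ w i (r • x)
  exists_le_sub_smul : ∀ i (n : ℤ) x y, w i y = n → (n : WithTop ℤ) ≤ w i x →
    ∃ r : R, ((n + 1 : ℤ) : WithTop ℤ) ≤ w i (x - r • y)
  exists_eq : ∀ α : ι → WithTop ℤ, ∃ x, ∀ i, w i x = α i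

theorem isLocalHom_algebraMap_integralClosure {A K : Type*} [CommRing A] [IsDomain A] [Field K]
    [Algebra A K] [IsFractionRing A K] :
    IsLocalHom (algebraMap A (integralClosure A K)) :=
  inferInstance

section

variable {R : Type u} [CommRing R]

theorem branchVal_eq_dvrVal (P : minimalPrimes R)
    [h : IsDiscreteValuationRing (BranchNormalization P)] (x : BranchField P) :
    branchVal P x = dvrVal (BranchNormalization P) (BranchField P) x := by
  rw [branchVal, dif_pos h]

/-- Lift a monic equation over `R / P` to a monic `g` over `R`. The polynomial `X * g` then vanishes
on branch `P` because of `g`, and on the other branches because of `X`. -/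
theorem isIntegral_of_projBranch_single [IsReduced R] (P : minimalPrimes R) {h : FractionRing R}
    (hP : projBranch P h ∈ BranchNormalization P)
    (hQ : ∀ Q : minimalPrimes R, Q ≠ P → projBranch Q h = 0) : IsIntegral R h := by
  obtain ⟨f, hf, hfh⟩ := hP
  obtain ⟨g, hg, -, hgm⟩ := Polynomial.lifts_and_natDegree_eq_and_monic
    ((Polynomial.mem_lifts f).2 (Polynomial.map_surjective (Ideal.Quotient.mk P.1)
      Ideal.Quotient.mk_surjective f)) hf
  refine ⟨Polynomial.X * g, Polynomial.monic_X.mul hgm, eq_zero_of_projBranch_eq_zero fun Q => ?_⟩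
  rw [Polynomial.eval₂_mul, Polynomial.eval₂_X, map_mul]
  by_cases hQP : Q = P
  · subst hQP
    rw [Polynomial.hom_eval₂]
    have hc : (projBranch Q).comp (algebraMap R (FractionRing R)) =
        (algebraMap (Branch Q) (BranchField Q)).comp (Ideal.Quotient.mk Q.1) :=
      RingHom.ext (projBranch_algebraMap Q)
    rw [hc, ← Polynomial.eval₂_map, hg, hfh, mul_zero]
  · rw [hQ Q hQP, zero_mul]

theorem projBranch_mem_branchNormalization (P : minimalPrimes R) {h : FractionRing R}
    (hh : IsIntegral R h) : projBranch P h ∈ BranchNormalization P :=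
  hh.map_of_comp_eq (Ideal.Quotient.mk P.1) (projBranch P)
    (RingHom.ext fun r => (projBranch_algebraMap P r).symm)

/-- The projection from the integral closure of `R` to the normalization of a branch. -/
noncomputable def projNormalization (P : minimalPrimes R) :
    integralClosure R (FractionRing R) →+* BranchNormalization P :=
  ((projBranch P).comp (integralClosure R (FractionRing R)).val.toRingHom).codRestrict
    (BranchNormalization P) fun h => projBranch_mem_branchNormalization P h.2

attribute [local instance] IsCompleteAdmissible.branch_isLocalRing

variable [Finite (minimalPrimes R)]

theorem projNormalization_surjective [IsReduced R] (P : minimalPrimes R) :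
    Function.Surjective (projNormalization P) := by
  rintro ⟨v, hv⟩
  obtain ⟨h, hP, hQ⟩ := exists_projBranch_eq_single P v
  exact ⟨⟨h, isIntegral_of_projBranch_single P (hP ▸ hv) hQ⟩, Subtype.ext hP⟩

variable [IsLocalRing R]

/-- Residual rationality is assumed for the integral closure of `R` in `K`. That ring surjects onto
the normalization of each branch, so the maximal ideal pulls back to a maximal one with the same
residue field. -/
theorem IsCompleteAdmissible.exists_sub_mem_maximalIdeal (hR : IsCompleteAdmissible R)
    (P : minimalPrimes R) [IsLocalRing (BranchNormalization P)] (v : BranchNormalization P) :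
    ∃ r : R, v - algebraMap (Branch P) (BranchNormalization P) (Ideal.Quotient.mk P.1 r) ∈
      maximalIdeal (BranchNormalization P) := by
  have := hR.isReduced
  have hs := projNormalization_surjective P
  obtain ⟨h, rfl⟩ := hs v
  have hmax := Ideal.comap_isMaximal_of_surjective (projNormalization P) hs
    (K := maximalIdeal (BranchNormalization P))
  obtain ⟨r, hr⟩ := hR.residuallyRational _ hmax (Ideal.Quotient.mk _ h)
  refine ⟨r, ?_⟩
  have h1 : h - algebraMap R (integralClosure R (FractionRing R)) r ∈
      (maximalIdeal (BranchNormalization P)).comap (projNormalization P) :=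
    Ideal.Quotient.eq.1 hr.symm
  have h2 : projNormalization P (algebraMap R (integralClosure R (FractionRing R)) r) =
      algebraMap (Branch P) (BranchNormalization P) (Ideal.Quotient.mk P.1 r) :=
    Subtype.ext (projBranch_algebraMap P r)
  rwa [Ideal.mem_comap, map_sub, h2] at h1

theorem IsCompleteAdmissible.isValuationFamily (hR : IsCompleteAdmissible R) {ι : Type*}
    (p : ι ≃ minimalPrimes R) :
    IsValuationFamily R (fun i (h : FractionRing R) => branchVal (p i) (projBranch (p i) h)) := by
  have := hR.isReduced
  have hD := isDiscreteValuationRing_branchNormalization (hR := hR)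
  refine ⟨?_, ?_, ?_, ?_, ?_⟩
  · intro i n x y hx hy
    simp only [map_add]
    exact le_branchVal_add _ _ _ _ hx hy
  · intro i n r x hx
    simp only [projBranch_smul]
    exact le_branchVal_mul _ _ _ _ hx
  · intro i n r x hr hx
    have := hD (p i)
    simp only [projBranch_smul, branchVal_eq_dvrVal, dvrVal_mul] at hx ⊢
    -- An integral extension is a local homomorphism, so an element of the maximal ideal of `R` is
    -- still a nonunit in the normalization.
    have h1 : 1 ≤ dvrVal (BranchNormalization (p i)) (BranchField (p i))
        (algebraMap (BranchNormalization (p i)) (BranchField (p i))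
          (algebraMap (Branch (p i)) (BranchNormalization (p i)) (Ideal.Quotient.mk (p i).1 r))) := by
      rw [one_le_dvrVal_algebraMap_iff, mem_maximalIdeal, mem_nonunits_iff]
      intro hu
      have h3 : Ideal.Quotient.mk (p i).1 r ∈ maximalIdeal (Branch (p i)) := by
        rw [← IsCompleteAdmissible.maximalIdeal_branch]
        exact Ideal.mem_map_of_mem _ hr
      have := isLocalHom_algebraMap_integralClosure (A := Branch (p i)) (K := BranchField (p i))
      exact (mem_maximalIdeal _).1 h3 (isUnit_of_map_unit _ _ hu)
    rw [add_comm, WithTop.coe_add]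
    exact add_le_add h1 hx
  · intro i n x y hy hx
    have := hD (p i)
    simp only [branchVal_eq_dvrVal] at hx hy ⊢
    have hy0 : projBranch (p i) y ≠ 0 := by
      rw [Ne, ← dvrVal_eq_top_iff (BranchNormalization (p i)), hy]
      exact WithTop.coe_ne_top
    -- The quotient `x / y` lies in the valuation ring; an `r ∈ R` with the same residue makes `x /
    -- y - r`, and hence `x - r • y`, gain at least one in value.
    have hq : 0 ≤ dvrVal (BranchNormalization (p i)) (BranchField (p i))
        (projBranch (p i) x / projBranch (p i) y) := by
      have h1 := dvrVal_mul (BranchNormalization (p i)) _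
        (projBranch (p i) x / projBranch (p i) y) (projBranch (p i) y)
      rw [div_mul_cancel₀ _ hy0, hy] at h1
      rw [h1] at hx
      cases h2 : dvrVal (BranchNormalization (p i)) (BranchField (p i))
          (projBranch (p i) x / projBranch (p i) y) with
      | top => exact le_top
      | coe m =>
        rw [h2] at hx
        have : n ≤ m + n := by exact_mod_cast hx
        exact_mod_cast (by omega : 0 ≤ m)
    obtain ⟨v, hv⟩ := (zero_le_dvrVal_iff _ _ _).1 hq
    obtain ⟨r, hr⟩ := hR.exists_sub_mem_maximalIdeal (p i) v
    refine ⟨r, ?_⟩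
    have h3 : projBranch (p i) (x - r • y) = algebraMap (BranchNormalization (p i)) _
        (v - algebraMap (Branch (p i)) (BranchNormalization (p i)) (Ideal.Quotient.mk (p i).1 r)) *
          projBranch (p i) y := by
      rw [map_sub, map_sub, projBranch_smul, hv, sub_mul, div_mul_cancel₀ _ hy0]
      rfl
    rw [h3, dvrVal_mul, hy, add_comm, WithTop.coe_add]
    exact add_le_add ((one_le_dvrVal_algebraMap_iff _ _ _).2 hr) le_rfl
  · intro α
    choose x hx using fun P : minimalPrimes R =>
      exists_dvrVal_eq (BranchNormalization P) (BranchField P) (α (p.symm P))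
    obtain ⟨h, hh⟩ := exists_projBranch_eq x
    refine ⟨h, fun i => ?_⟩
    have := hD (p i)
    simp only [branchVal_eq_dvrVal, hh, hx, Equiv.symm_apply_apply]

end
section

variable {R : Type u} [CommRing R]

theorem mem_branchNormalization_iff (P : minimalPrimes R)
    [IsDiscreteValuationRing (BranchNormalization P)] (x : BranchField P) :
    x ∈ BranchNormalization P ↔ 0 ≤ branchVal P x := by
  rw [branchVal_eq_dvrVal, zero_le_dvrVal_iff]
  exact ⟨fun h => ⟨⟨x, h⟩, rfl⟩, by rintro ⟨a, rfl⟩; exact a.2⟩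

theorem branchVal_eq_top_iff (P : minimalPrimes R) (x : BranchField P) :
    branchVal P x = ⊤ ↔ x = 0 := by
  by_cases h : IsDiscreteValuationRing (BranchNormalization P)
  · rw [branchVal_eq_dvrVal, dvrVal_eq_top_iff]
  · by_cases hx : x = 0 <;> simp [branchVal, h, hx]

theorem zero_le_branchVal_algebraMap (P : minimalPrimes R)
    [IsDiscreteValuationRing (BranchNormalization P)] (r : R) :
    0 ≤ branchVal P (projBranch P (algebraMap R (FractionRing R) r)) := by
  rw [← mem_branchNormalization_iff, projBranch_algebraMap]
  exact (BranchNormalization P).algebraMap_mem _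

theorem projPartialBranch_projPartial {ι : Type*} (p : ι → minimalPrimes R) (J : Finset ι) (j : J)
    (h : FractionRing R) : projPartialBranch p J j (projPartial p J h) = projBranch (p j) h := by
  have : (projPartialBranch p J j).comp (projPartial p J) = projBranch (p j) := by
    refine IsLocalization.ringHom_ext R⁰ (RingHom.ext fun r => ?_)
    simp [projPartialBranch, projPartial, projBranch, IsLocalization.map_eq]
  exact congrArg (fun f => f h) this

theorem mem_nonZeroDivisors_of_projPartialBranch_ne_zero {ι : Type*} (p : ι → minimalPrimes R)
    (J : Finset ι) {g : PartialFractions p J} (hg : ∀ j, projPartialBranch p J j g ≠ 0) :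
    g ∈ (PartialFractions p J)⁰ := by
  rw [mem_nonZeroDivisors_iff_right]
  intro z hz
  have hz' : ∀ j, projPartialBranch p J j z = 0 := fun j => by
    refine (mul_eq_zero.1 ?_).resolve_right (hg j)
    rw [← map_mul, hz, map_zero]
  obtain ⟨a, s, rfl⟩ := IsLocalization.exists_mk'_eq (PartialRing p J)⁰ z
  obtain ⟨a, rfl⟩ := Ideal.Quotient.mk_surjective a
  have : a ∈ interIdeal p J := by
    rw [interIdeal, Ideal.mem_iInf]
    intro j
    rw [Ideal.mem_iInf]
    intro hj
    have h1 : projPartialBranch p J ⟨j, hj⟩ (algebraMap (PartialRing p J) _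
        (Ideal.Quotient.mk _ a)) = 0 := by
      rw [← IsLocalization.mk'_spec (PartialFractions p J) (Ideal.Quotient.mk _ a) s, map_mul, hz',
        zero_mul]
    rw [projPartialBranch, IsLocalization.map_eq,
      map_eq_zero_iff _ (IsFractionRing.injective _ _), Ideal.Quotient.factor_mk,
      Ideal.Quotient.eq_zero_iff_mem] at h1
    exact h1
  rw [Ideal.Quotient.eq_zero_iff_mem.2 this, IsLocalization.mk'_zero]

/-- Regularity need not be required separately: finite values force all components to be nonzero. -/
theorem mem_partialValueSet_iff {ι : Type*} (p : ι → minimalPrimes R)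
    (𝓘 : FractionalIdeal R⁰ (FractionRing R)) (J : Finset ι) (β : J → ℤ) :
    β ∈ partialValueSet p 𝓘 J ↔
      ∃ h ∈ 𝓘, ∀ j : J, branchVal (p j) (projBranch (p j) h) = (β j : WithTop ℤ) := by
  constructor
  · rintro ⟨_, ⟨h, hh, rfl⟩, -, hval⟩
    refine ⟨h, hh, fun j => ?_⟩
    rw [← hval j, projPartialBranch_projPartial]
  · rintro ⟨h, hh, hval⟩
    refine ⟨projPartial p J h, ⟨h, hh, rfl⟩,
      mem_nonZeroDivisors_of_projPartialBranch_ne_zero p J fun j h0 => ?_, fun j => ?_⟩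
    · rw [projPartialBranch_projPartial] at h0
      have := hval j
      rw [h0, branchVal_zero] at this
      exact WithTop.top_ne_coe this
    · rw [projPartialBranch_projPartial, hval]

theorem mem_valueSet_iff [Finite (minimalPrimes R)] [IsReduced R] {ι : Type*}
    (p : ι ≃ minimalPrimes R) (𝓘 : FractionalIdeal R⁰ (FractionRing R)) (α : ι → ℤ) :
    α ∈ valueSet p 𝓘 ↔
      ∃ h ∈ 𝓘, ∀ i, branchVal (p i) (projBranch (p i) h) = (α i : WithTop ℤ) := by
  constructor
  · rintro ⟨h, hh, -, hval⟩
    exact ⟨h, hh, hval⟩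
  · rintro ⟨h, hh, hval⟩
    refine ⟨h, hh, (mem_nonZeroDivisors_fractionRing_iff h).2 fun P h0 => ?_, hval⟩
    have := hval (p.symm P)
    rw [p.apply_symm_apply, h0, branchVal_zero] at this
    exact WithTop.top_ne_coe this

variable [IsLocalRing R] [Finite (minimalPrimes R)]

/-- Some regular element of `R` multiplies the product of the normalizations of the branches
into `R`. -/
theorem IsCompleteAdmissible.exists_mul_mem (hR : IsCompleteAdmissible R) :
    ∃ s ∈ R⁰, ∀ h : FractionRing R,
      (∀ P : minimalPrimes R, projBranch P h ∈ BranchNormalization P) →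
        ∃ r : R, algebraMap R (FractionRing R) r = s • h := by
  classical
  have := hR.isReduced
  have := Fintype.ofFinite (minimalPrimes R)
  choose G hG hG' using exists_projBranch_eq_single (R := R)
  have hfin : ∀ P : minimalPrimes R, ∃ S : Finset (BranchNormalization P),
      Submodule.span (Branch P) (S : Set (BranchNormalization P)) = ⊤ := fun P =>
    (hR.finite_branchNormalization P).fg_top
  choose S hS using hfin
  -- Extend module generators of each branch normalization by zero to elements of `K`. A common
  -- denominator `s` of this finite set works for all combinations, since extension by zero is
  -- `R`-linear.
  let T : Finset (FractionRing R) :=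
    Finset.univ.biUnion fun P => (S P).image fun v : BranchNormalization P => G P (v : BranchField P)
  obtain ⟨s, hs⟩ := IsLocalization.exist_integer_multiples_of_finset R⁰ T
  let N : Submodule R (FractionRing R) :=
    (LinearMap.range (Algebra.linearMap R (FractionRing R))).comap
      (LinearMap.lsmul R (FractionRing R) s)
  have hsingle : ∀ (P : minimalPrimes R) (v : BranchNormalization P), G P v ∈ N := by
    intro P v
    have hv : v ∈ Submodule.span (Branch P) (S P : Set (BranchNormalization P)) := hS P ▸ trivial
    induction hv using Submodule.span_induction with
    | mem v hv =>
      exact hs _ (Finset.mem_biUnion.2 ⟨P, Finset.mem_univ P, Finset.mem_image_of_mem _ hv⟩)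
    | zero =>
      have : G P ((0 : BranchNormalization P) : BranchField P) = 0 := by
        refine eq_zero_of_projBranch_eq_zero fun Q => ?_
        by_cases hQ : Q = P
        · subst hQ; exact hG Q _
        · exact hG' P _ Q hQ
      rw [this]
      exact N.zero_mem
    | add x y _ _ hx hy =>
      have : G P ((x + y : BranchNormalization P) : BranchField P) = G P x + G P y := by
        rw [← sub_eq_zero]
        refine eq_zero_of_projBranch_eq_zero fun Q => ?_
        by_cases hQ : Q = P
        · subst hQ; simp [hG]
        · simp [hG' P _ Q hQ]
      rw [this]
      exact N.add_mem hx hy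
    | smul a x _ hx =>
      obtain ⟨r, rfl⟩ := Ideal.Quotient.mk_surjective a
      have : G P ((Ideal.Quotient.mk P.1 r • x : BranchNormalization P) : BranchField P) =
          r • G P x := by
        rw [← sub_eq_zero]
        refine eq_zero_of_projBranch_eq_zero fun Q => ?_
        rw [map_sub, projBranch_smul]
        by_cases hQ : Q = P
        · subst hQ
          rw [hG, hG, sub_eq_zero]
          exact Algebra.smul_def _ _
        · rw [hG' P _ Q hQ, hG' P _ Q hQ, mul_zero, sub_zero]
      rw [this]
      exact N.smul_mem r hx
  refine ⟨s, s.2, fun h hh => ?_⟩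
  have hsum : h = ∑ P, G P (projBranch P h) := by
    rw [← sub_eq_zero]
    refine eq_zero_of_projBranch_eq_zero fun Q => ?_
    rw [map_sub, map_sum, Finset.sum_eq_single Q (fun P _ hP => hG' P _ Q hP.symm) (by simp), hG,
      sub_self]
  have : h ∈ N := by
    rw [hsum]
    exact N.sum_mem fun P _ => hsingle P ⟨projBranch P h, hh P⟩
  exact this

/-- Let `d ∈ 𝓘` be regular and let `s` multiply the normalizations into `R`. If the values of `h`
are at least those of `d * s`, then `h / (d * s)` is integral on each branch, so `h = d * (s * (h /
(d * s)))` is a multiple of `d` by an element of `R`. -/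
theorem IsCompleteAdmissible.exists_forall_le_branchVal_imp_mem (hR : IsCompleteAdmissible R)
    (𝓘 : FractionalIdeal R⁰ (FractionRing R))
    (h𝓘 : ∃ d ∈ R⁰, algebraMap R (FractionRing R) d ∈ 𝓘) :
    ∃ N : ℤ, ∀ h : FractionRing R,
      (∀ P : minimalPrimes R, (N : WithTop ℤ) ≤ branchVal P (projBranch P h)) → h ∈ 𝓘 := by
  have := hR.isReduced
  have hD := isDiscreteValuationRing_branchNormalization (hR := hR)
  have := Fintype.ofFinite (minimalPrimes R)
  obtain ⟨d, hd, hdI⟩ := h𝓘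
  obtain ⟨s, hs, hsR⟩ := hR.exists_mul_mem
  have hne : ∀ P : minimalPrimes R,
      branchVal P (projBranch P (algebraMap R (FractionRing R) (d * s))) ≠ ⊤ := by
    intro P
    rw [Ne, branchVal_eq_top_iff, projBranch_algebraMap_eq_zero_iff]
    exact fun h => Set.disjoint_left.mp (Ideal.disjoint_nonZeroDivisors_of_mem_minimalPrimes P.2)
      h (mul_mem hd hs)
  choose m hm using fun P => WithTop.ne_top_iff_exists.1 (hne P)
  obtain ⟨N, hN⟩ := (Set.finite_range m).bddAbove
  refine ⟨N, fun h hh => ?_⟩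
  have hu : IsUnit (algebraMap R (FractionRing R) (d * s)) :=
    IsLocalization.map_units (FractionRing R) (⟨d * s, mul_mem hd hs⟩ : R⁰)
  obtain ⟨u, hu⟩ := hu
  have hfac : h = d • (s • (↑u⁻¹ * h)) := by
    rw [smul_smul, Algebra.smul_def, ← hu, Units.mul_inv_cancel_left]
  obtain ⟨r, hr⟩ := hsR (↑u⁻¹ * h) fun P => by
    have := hD P
    rw [mem_branchNormalization_iff]
    have h1 : h = algebraMap R (FractionRing R) (d * s) * (↑u⁻¹ * h) := by
      rw [← hu, Units.mul_inv_cancel_left]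
    have h2 := hh P
    rw [h1, map_mul, branchVal_eq_dvrVal, dvrVal_mul, ← branchVal_eq_dvrVal, ← hm P,
      ← branchVal_eq_dvrVal] at h2
    cases h3 : branchVal P (projBranch P (↑u⁻¹ * h)) with
    | top => exact le_top
    | coe k =>
      rw [h3] at h2
      have h4 : N ≤ m P + k := by exact_mod_cast h2
      have h5 : m P ≤ N := hN ⟨P, rfl⟩
      exact_mod_cast (by omega : 0 ≤ k)
  rw [hfac, ← hr, Algebra.smul_def, mul_comm, ← Algebra.smul_def]
  exact (𝓘 : Submodule R (FractionRing R)).smul_mem r hdI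

/-- A common denominator `d` brings `h` into `R`, where values are nonnegative; so the values of `h`
are at least minus those of `d`. -/
theorem IsCompleteAdmissible.exists_forall_mem_le_branchVal (hR : IsCompleteAdmissible R)
    (𝓘 : FractionalIdeal R⁰ (FractionRing R)) :
    ∃ B : ℤ, ∀ h ∈ 𝓘, ∀ P : minimalPrimes R, (B : WithTop ℤ) ≤ branchVal P (projBranch P h) := by
  have hD := isDiscreteValuationRing_branchNormalization (hR := hR)
  have := Fintype.ofFinite (minimalPrimes R)
  obtain ⟨d, hd, hdI⟩ := 𝓘.2
  have hne : ∀ P : minimalPrimes R,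
      branchVal P (projBranch P (algebraMap R (FractionRing R) d)) ≠ ⊤ := by
    intro P
    rw [Ne, branchVal_eq_top_iff, projBranch_algebraMap_eq_zero_iff]
    exact fun h => Set.disjoint_left.mp (Ideal.disjoint_nonZeroDivisors_of_mem_minimalPrimes P.2)
      h hd
  choose m hm using fun P => WithTop.ne_top_iff_exists.1 (hne P)
  obtain ⟨N, hN⟩ := (Set.finite_range m).bddAbove
  refine ⟨-N, fun h hh P => ?_⟩
  obtain ⟨r, hr⟩ := hdI h hh
  have := hD P
  have h1 := zero_le_branchVal_algebraMap P r
  rw [hr, Algebra.smul_def, map_mul, branchVal_eq_dvrVal, dvrVal_mul, ← branchVal_eq_dvrVal,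
    ← branchVal_eq_dvrVal, ← hm P] at h1
  cases h3 : branchVal P (projBranch P h) with
  | top => exact le_top
  | coe k =>
    rw [h3] at h1
    have h4 : 0 ≤ m P + k := by exact_mod_cast h1
    have h5 : m P ≤ N := hN ⟨P, rfl⟩
    exact_mod_cast (by omega : -N ≤ k)

end
end AdmissibleRing

end

/-! ### Value sets of valuation families are good sets. -/

section

open IsLocalRing
namespace AdmissibleRing

/-- The combinatorial properties of the value set of a regular fractional ideal. -/
structure IsGoodSet {ι : Type*} (E : Set (ι → ℤ)) : Prop where
  inf_mem : ∀ α ∈ E, ∀ β ∈ E, α ⊓ β ∈ E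
  exchange : ∀ α ∈ E, ∀ β ∈ E, ∀ i, α i = β i → ∃ ε ∈ E, α i < ε i ∧
    ∀ j, min (α j) (β j) ≤ ε j ∧ (α j ≠ β j → ε j = min (α j) (β j))
  exists_Ici_subset : ∃ δ, Set.Ici δ ⊆ E
  bddBelow : BddBelow E

/-- The axioms of a valuation family are mostly stated through integer thresholds; this recovers
exact values. -/
theorem withTop_eq_intCast_iff {a : WithTop ℤ} {n : ℤ} :
    a = n ↔ (n : WithTop ℤ) ≤ a ∧ ¬ ((n + 1 : ℤ) : WithTop ℤ) ≤ a := by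
  cases a with
  | top => simp
  | coe a =>
    rw [WithTop.coe_eq_coe, WithTop.coe_le_coe, WithTop.coe_le_coe]
    omega

namespace IsValuationFamily

variable {R K ι : Type*} [CommRing R] [IsLocalRing R] [AddCommGroup K] [Module R K]
  {w : ι → K → WithTop ℤ}

theorem le_sub (hw : IsValuationFamily R w) {i : ι} {n : ℤ} {x y : K}
    (hx : (n : WithTop ℤ) ≤ w i x) (hy : (n : WithTop ℤ) ≤ w i y) :
    (n : WithTop ℤ) ≤ w i (x - y) := by
  rw [sub_eq_add_neg, ← neg_one_smul R y]
  exact hw.le_add i n _ _ hx (hw.le_smul i n _ _ hy)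

theorem le_of_le_smul (hw : IsValuationFamily R w) {i : ι} {n : ℤ} {r : R} (hr : IsUnit r) {x : K}
    (h : (n : WithTop ℤ) ≤ w i (r • x)) : (n : WithTop ℤ) ≤ w i x := by
  obtain ⟨u, rfl⟩ := hr
  have := hw.le_smul i n (↑u⁻¹ : R) _ h
  rwa [smul_smul, Units.inv_mul, one_smul] at this

theorem smul_eq (hw : IsValuationFamily R w) {i : ι} {n : ℤ} {r : R} (hr : IsUnit r) {x : K}
    (h : w i x = n) : w i (r • x) = n := by
  rw [withTop_eq_intCast_iff] at h ⊢
  exact ⟨hw.le_smul i n r x h.1, fun h' => h.2 (hw.le_of_le_smul hr h')⟩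

theorem add_eq (hw : IsValuationFamily R w) {i : ι} {n : ℤ} {x y : K} (hx : w i x = n)
    (hy : ((n + 1 : ℤ) : WithTop ℤ) ≤ w i y) : w i (x + y) = n := by
  rw [withTop_eq_intCast_iff] at hx ⊢
  refine ⟨hw.le_add i n _ _ hx.1 (le_trans (WithTop.coe_le_coe.2 (by omega)) hy), fun h => hx.2 ?_⟩
  have := hw.le_sub h hy
  rwa [add_sub_cancel_right] at this

theorem sub_eq_left (hw : IsValuationFamily R w) {i : ι} {n : ℤ} {x y : K} (hx : w i x = n)
    (hy : ((n + 1 : ℤ) : WithTop ℤ) ≤ w i y) : w i (x - y) = n := by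
  rw [sub_eq_add_neg, ← neg_one_smul R y]
  exact hw.add_eq hx (hw.le_smul i _ _ _ hy)

theorem sub_eq_right (hw : IsValuationFamily R w) {i : ι} {n : ℤ} {x y : K} (hy : w i y = n)
    (hx : ((n + 1 : ℤ) : WithTop ℤ) ≤ w i x) : w i (x - y) = n := by
  rw [sub_eq_neg_add, ← neg_one_smul R y]
  exact hw.add_eq (hw.smul_eq isUnit_one.neg hy) hx

section Ideal

variable {I : Submodule R K}

/-- An element of `I` can be changed, only in the coordinates where its value is infinite, so as to
have finite values. -/
theorem exists_finite_values (hw : IsValuationFamily R w)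
    (hN : ∃ N : ℤ, ∀ h, (∀ i, (N : WithTop ℤ) ≤ w i h) → h ∈ I) {h : K} (hh : h ∈ I) (M : ℤ) :
    ∃ α : ι → ℤ, (∃ h' ∈ I, ∀ i, w i h' = α i) ∧
      ∀ i, w i h = α i ∨ w i h = ⊤ ∧ M ≤ α i := by
  classical
  obtain ⟨N, hN⟩ := hN
  obtain ⟨t, ht⟩ := hw.exists_eq
    (fun i => if w i h = ⊤ then ((max N M : ℤ) : WithTop ℤ) else ⊤)
  have htI : t ∈ I := hN t fun i => by
    rw [ht]
    split_ifs
    · exact WithTop.coe_le_coe.2 (le_max_left _ _)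
    · exact le_top
  have key : ∀ i, ∃ n : ℤ, w i (h + t) = n ∧ (w i h = n ∨ w i h = ⊤ ∧ M ≤ n) := by
    intro i
    cases hi : w i h with
    | top =>
      refine ⟨max N M, ?_, Or.inr ⟨rfl, le_max_right _ _⟩⟩
      rw [add_comm]
      exact hw.add_eq (by rw [ht, if_pos hi]) (by rw [hi]; exact le_top)
    | coe n =>
      refine ⟨n, hw.add_eq hi ?_, Or.inl rfl⟩
      rw [ht, if_neg (by rw [hi]; exact WithTop.coe_ne_top)]
      exact le_top
  choose α hα hα' using key
  exact ⟨α, ⟨h + t, I.add_mem hh htI, hα⟩, hα'⟩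

/-- Look at `f + r • g`, with `r` running over representatives of the residue field. At each
coordinate at most one residue class gives a value above the minimum, and where `α < β` none does.
So there are fewer bad classes than coordinates, hence fewer than residues. -/
theorem inf_mem (hw : IsValuationFamily R w) [Finite ι]
    (hk : ENat.card ι ≤ ENat.card (ResidueField R)) {α β : ι → ℤ}
    (hα : ∃ h ∈ I, ∀ i, w i h = α i) (hβ : ∃ h ∈ I, ∀ i, w i h = β i) :
    ∃ h ∈ I, ∀ i, w i h = (α ⊓ β) i := by
  by_cases hle : β ≤ α
  · rwa [inf_eq_right.2 hle]
  obtain ⟨i₀, hi₀⟩ : ∃ i, α i < β i := by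
    by_contra! h
    exact hle h
  obtain ⟨f, hf, hfα⟩ := hα
  obtain ⟨g, hg, hgβ⟩ := hβ
  choose r hr using residue_surjective (R := R)
  by_contra! hcon
  -- Suppose every class `c` is bad, and let `φ c` be a coordinate witnessing this. Then `φ` is
  -- injective and misses `i₀`, although the residue field has at least as many elements as `ι`.
  have hbad : ∀ c, ∃ j, w j (f + r c • g) ≠ ((α ⊓ β) j : ℤ) := fun c =>
    hcon _ (I.add_mem hf (I.smul_mem _ hg))
  choose φ hφ using hbad
  have hmin : ∀ j, (((α ⊓ β) j : ℤ) : WithTop ℤ) ≤ w j f ∧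
      (((α ⊓ β) j : ℤ) : WithTop ℤ) ≤ w j g := fun j => by
    rw [hfα, hgβ]
    exact ⟨WithTop.coe_le_coe.2 inf_le_left, WithTop.coe_le_coe.2 inf_le_right⟩
  have hφ' : ∀ c, (((α ⊓ β) (φ c) + 1 : ℤ) : WithTop ℤ) ≤ w (φ c) (f + r c • g) := fun c => by
    by_contra h
    exact hφ c (withTop_eq_intCast_iff.2 ⟨hw.le_add _ _ _ _ (hmin _).1
      (hw.le_smul _ _ _ _ (hmin _).2), h⟩)
  have hne : ∀ c, φ c ≠ i₀ := by
    intro c hc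
    refine hφ c ?_
    have : (α ⊓ β) i₀ = α i₀ := min_eq_left hi₀.le
    rw [hc, this]
    exact hw.add_eq (hfα i₀) (hw.le_smul _ _ _ _ (by
      rw [hgβ]; exact WithTop.coe_le_coe.2 (by omega)))
  have hinj : Function.Injective φ := by
    intro c c' hcc
    by_contra hne
    have hu : IsUnit (r c - r c') := by
      rw [← residue_ne_zero_iff_isUnit, map_sub, hr, hr]
      exact sub_ne_zero.2 hne
    have h1 := hφ' c
    have h2 := hφ' c'
    rw [← hcc] at h2
    have h3 : (((α ⊓ β) (φ c) + 1 : ℤ) : WithTop ℤ) ≤ w (φ c) g := by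
      refine hw.le_of_le_smul hu ?_
      have := hw.le_sub h1 h2
      rwa [add_sub_add_left_eq_sub, ← sub_smul] at this
    have h4 : (((α ⊓ β) (φ c) + 1 : ℤ) : WithTop ℤ) ≤ w (φ c) f := by
      have := hw.le_sub h1 (hw.le_smul _ _ (r c) _ h3)
      rwa [add_sub_cancel_right] at this
    rw [hgβ, WithTop.coe_le_coe] at h3
    rw [hfα, WithTop.coe_le_coe] at h4
    have h5 : (α ⊓ β) (φ c) = min (α (φ c)) (β (φ c)) := rfl
    omega
  have : Finite (ResidueField R) := Finite.of_injective φ hinj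
  have := Fintype.ofFinite ι
  have := Fintype.ofFinite (ResidueField R)
  have hcard : Fintype.card ι ≤ Fintype.card (ResidueField R) := by
    rw [ENat.card_eq_coe_fintype_card, ENat.card_eq_coe_fintype_card] at hk
    exact_mod_cast hk
  have hbij := (Fintype.bijective_iff_injective_and_card φ).2
    ⟨hinj, le_antisymm (Fintype.card_le_of_injective φ hinj) hcard⟩
  obtain ⟨c, hc⟩ := hbij.2 i₀
  exact hne c hc

/-- Cancel the leading terms at `i`: some `f - r • g` has larger value there. The scalar `r` must be
a unit, so elsewhere `r • g` has the values of `g` and the ultrametric inequality applies. -/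
theorem exchange [Finite ι] (hw : IsValuationFamily R w)
    (hN : ∃ N : ℤ, ∀ h, (∀ i, (N : WithTop ℤ) ≤ w i h) → h ∈ I) {α β : ι → ℤ}
    (hα : ∃ h ∈ I, ∀ i, w i h = α i) (hβ : ∃ h ∈ I, ∀ i, w i h = β i) {i : ι} (hi : α i = β i) :
    ∃ ε : ι → ℤ, (∃ h ∈ I, ∀ i, w i h = ε i) ∧ α i < ε i ∧
      ∀ j, min (α j) (β j) ≤ ε j ∧ (α j ≠ β j → ε j = min (α j) (β j)) := by
  obtain ⟨f, hf, hfα⟩ := hα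
  obtain ⟨g, hg, hgβ⟩ := hβ
  obtain ⟨r, hr⟩ := hw.exists_le_sub_smul i (α i) f g (by rw [hgβ, hi]) (hfα i).ge
  have hu : IsUnit r := by
    by_contra hu
    have h1 := hw.le_smul_of_mem i (α i) r g ((mem_maximalIdeal r).2 hu) (by rw [hgβ, hi])
    have h2 := hw.le_add _ _ _ _ hr h1
    rw [sub_add_cancel, hfα, WithTop.coe_le_coe] at h2
    omega
  obtain ⟨M, hM⟩ := (Set.finite_range (α ⊔ β)).bddAbove
  have hM' : ∀ j, α j ≤ M ∧ β j ≤ M := fun j =>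
    ⟨le_trans le_sup_left (hM ⟨j, rfl⟩ : (α ⊔ β) j ≤ M),
      le_trans le_sup_right (hM ⟨j, rfl⟩ : (α ⊔ β) j ≤ M)⟩
  -- Infinite values of the difference are replaced by values above all `α j` and `β j`, so the
  -- lower bounds survive. Where `α j ≠ β j` the value is already finite and is not changed.
  obtain ⟨ε, hε, hε'⟩ := hw.exists_finite_values hN (I.sub_mem hf (I.smul_mem r hg)) (M + 1)
  refine ⟨ε, hε, ?_, fun j => ?_⟩
  · rcases hε' i with h | ⟨-, h⟩
    · rw [h, WithTop.coe_le_coe] at hr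
      omega
    · have := (hM' i).1
      omega
  · have hrg : w j (r • g) = β j := hw.smul_eq hu (hgβ j)
    have hle : ((min (α j) (β j) : ℤ) : WithTop ℤ) ≤ w j (f - r • g) :=
      hw.le_sub (by rw [hfα]; exact WithTop.coe_le_coe.2 (min_le_left _ _))
        (by rw [hrg]; exact WithTop.coe_le_coe.2 (min_le_right _ _))
    refine ⟨?_, fun hne => ?_⟩
    · rcases hε' j with h | ⟨-, h⟩
      · rwa [h, WithTop.coe_le_coe] at hle
      · have := hM' j
        omega
    · have heq : w j (f - r • g) = (min (α j) (β j) : ℤ) := by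
        rcases lt_or_gt_of_ne hne with h | h
        · rw [min_eq_left h.le]
          exact hw.sub_eq_left (hfα j) (by rw [hrg]; exact WithTop.coe_le_coe.2 h)
        · rw [min_eq_right h.le]
          exact hw.sub_eq_right hrg (by rw [hfα]; exact WithTop.coe_le_coe.2 h)
      rcases hε' j with h | ⟨h, -⟩
      · rw [heq, WithTop.coe_eq_coe] at h
        exact h.symm
      · rw [heq] at h
        exact absurd h WithTop.coe_ne_top

theorem isGoodSet [Finite ι] (hw : IsValuationFamily R w)
    (hk : ENat.card ι ≤ ENat.card (ResidueField R))
    (hN : ∃ N : ℤ, ∀ h, (∀ i, (N : WithTop ℤ) ≤ w i h) → h ∈ I)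
    (hB : ∃ B : ℤ, ∀ h ∈ I, ∀ i, (B : WithTop ℤ) ≤ w i h) :
    IsGoodSet {α : ι → ℤ | ∃ h ∈ I, ∀ i, w i h = α i} where
  inf_mem _ hα _ hβ := hw.inf_mem hk hα hβ
  exchange _ hα _ hβ _ hi := hw.exchange hN hα hβ hi
  exists_Ici_subset := by
    obtain ⟨N, hN⟩ := hN
    refine ⟨fun _ => N, fun α hα => ?_⟩
    obtain ⟨h, hh⟩ := hw.exists_eq fun i => (α i : WithTop ℤ)
    exact ⟨h, hN h fun i => by rw [hh]; exact WithTop.coe_le_coe.2 (hα i), hh⟩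
  bddBelow := by
    obtain ⟨B, hB⟩ := hB
    refine ⟨fun _ => B, fun α ⟨h, hh, hα⟩ i => ?_⟩
    have := hB h hh i
    rwa [hα, WithTop.coe_le_coe] at this

end Ideal

end IsValuationFamily
end AdmissibleRing

end

/-! ### Lengths of successive truncations. -/

section

open IsLocalRing

theorem Module.length_quotient_submoduleOf_add {R K : Type*} [CommRing R] [AddCommGroup K]
    [Module R K] {I T T' : Submodule R K} (h : T' ≤ T) (hT : T ≤ I) :
    Module.length R (I ⧸ T'.submoduleOf I) =
      Module.length R (T ⧸ T'.submoduleOf T) + Module.length R (I ⧸ T.submoduleOf I) := by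
  let f : (T ⧸ T'.submoduleOf T) →ₗ[R] (I ⧸ T'.submoduleOf I) :=
    Submodule.mapQ _ _ (Submodule.inclusion hT) fun y hy => hy
  have hle : T'.submoduleOf I ≤ T.submoduleOf I := fun y hy => h hy
  let g : (I ⧸ T'.submoduleOf I) →ₗ[R] (I ⧸ T.submoduleOf I) := Submodule.factor hle
  refine Module.length_eq_add_of_exact f g ?_ (Submodule.factor_surjective hle) ?_
  · rw [← LinearMap.ker_eq_bot, LinearMap.ker_eq_bot']
    intro y
    induction y using Submodule.Quotient.induction_on with | _ y
    intro hy
    exact (Submodule.Quotient.mk_eq_zero _).2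
      ((Submodule.Quotient.mk_eq_zero (T'.submoduleOf I)).1 hy :)
  · intro y
    induction y using Submodule.Quotient.induction_on with | _ y
    constructor
    · intro hy
      have hy : y ∈ T.submoduleOf I := by simpa [g] using hy
      exact ⟨Submodule.Quotient.mk ⟨y, hy⟩, rfl⟩
    · rintro ⟨z, hz⟩
      induction z using Submodule.Quotient.induction_on with | _ z
      rw [← hz]
      exact (Submodule.Quotient.mk_eq_zero (T.submoduleOf I)).2 z.2

namespace AdmissibleRing

namespace IsValuationFamily

variable {R K ι : Type*} [CommRing R] [IsLocalRing R] [AddCommGroup K] [Module R K]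
  {w : ι → K → WithTop ℤ} {I : Submodule R K} {T : (ι → ℤ) → Submodule R K}

/-- Any element of value exactly `α i` at `i` generates the quotient, because `exists_le_sub_smul`
removes the leading term of any other element. -/
theorem length_truncation_quotient_eq_one [DecidableEq ι] (hw : IsValuationFamily R w)
    (hT : ∀ α h, h ∈ T α ↔ h ∈ I ∧ ∀ i, (α i : WithTop ℤ) ≤ w i h) (α : ι → ℤ) (i : ι)
    (hex : ∃ h ∈ T α, w i h = α i) :
    Module.length R (T α ⧸ (T (Function.update α i (α i + 1))).submoduleOf (T α)) = 1 := by
  have hmem : ∀ h, h ∈ T α → (h ∈ T (Function.update α i (α i + 1)) ↔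
      ((α i + 1 : ℤ) : WithTop ℤ) ≤ w i h) := by
    intro h hh
    rw [hT] at hh ⊢
    constructor
    · intro h'
      simpa using h'.2 i
    · intro h'
      refine ⟨hh.1, fun j => ?_⟩
      by_cases hj : j = i
      · subst hj; simpa using h'
      · simpa [hj] using hh.2 j
  rw [Module.length_eq_one_iff, isSimpleModule_iff_toSpanSingleton_surjective]
  obtain ⟨y, hy, hyα⟩ := hex
  constructor
  · refine ⟨⟨Submodule.Quotient.mk ⟨y, hy⟩, 0, fun h0 => ?_⟩⟩
    rw [Submodule.Quotient.mk_eq_zero, Submodule.submoduleOf, Submodule.mem_comap,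
      Submodule.subtype_apply, hmem _ hy, hyα, WithTop.coe_le_coe] at h0
    omega
  · intro m hm x
    induction m using Submodule.Quotient.induction_on with | _ m
    induction x using Submodule.Quotient.induction_on with | _ x
    have hmα : w i m = α i := by
      rw [withTop_eq_intCast_iff]
      refine ⟨((hT _ _).1 m.2).2 i, fun h => hm ?_⟩
      rw [Submodule.Quotient.mk_eq_zero, Submodule.submoduleOf, Submodule.mem_comap,
        Submodule.subtype_apply, hmem _ m.2]
      exact h
    obtain ⟨r, hr⟩ := hw.exists_le_sub_smul i (α i) x m hmα (((hT _ _).1 x.2).2 i)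
    refine ⟨r, ?_⟩
    rw [LinearMap.toSpanSingleton_apply, ← Submodule.Quotient.mk_smul, eq_comm,
      Submodule.Quotient.eq, Submodule.submoduleOf, Submodule.mem_comap, Submodule.subtype_apply,
      hmem _ (x - r • m).2]
    exact hr

open Classical in
theorem length_quotient_truncation_update [Finite ι] [DecidableEq ι] (hw : IsValuationFamily R w)
    (hN : ∃ N : ℤ, ∀ h, (∀ i, (N : WithTop ℤ) ≤ w i h) → h ∈ I)
    (hT : ∀ α h, h ∈ T α ↔ h ∈ I ∧ ∀ i, (α i : WithTop ℤ) ≤ w i h) (α : ι → ℤ) (i : ι) :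
    Module.length R (I ⧸ (T (Function.update α i (α i + 1))).submoduleOf I) =
      Module.length R (I ⧸ (T α).submoduleOf I) +
        if ∃ β ∈ {β : ι → ℤ | ∃ h ∈ I, ∀ i, w i h = β i}, α ≤ β ∧ β i = α i then 1 else 0 := by
  have hle : T (Function.update α i (α i + 1)) ≤ T α := by
    intro h hh
    rw [hT] at hh ⊢
    refine ⟨hh.1, fun j => le_trans (WithTop.coe_le_coe.2 ?_) (hh.2 j)⟩
    by_cases hj : j = i
    · subst hj; simp
    · simp [hj]
  have hle' : T α ≤ I := fun h hh => ((hT _ _).1 hh).1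
  rw [Module.length_quotient_submoduleOf_add hle hle', add_comm]
  congr 1
  split_ifs with hc
  · obtain ⟨β, ⟨h, hh, hβ⟩, hαβ, hβi⟩ := hc
    refine hw.length_truncation_quotient_eq_one hT α i ⟨h, (hT _ _).2 ⟨hh, fun j => ?_⟩, ?_⟩
    · rw [hβ]; exact WithTop.coe_le_coe.2 (hαβ j)
    · rw [hβ, hβi]
  · rw [Module.length_eq_zero_iff, Submodule.Quotient.subsingleton_iff, eq_top_iff]
    rintro ⟨h, hh⟩ -
    rw [Submodule.submoduleOf, Submodule.mem_comap, Submodule.subtype_apply, hT]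
    have hh' := (hT _ _).1 hh
    refine ⟨hh'.1, fun j => ?_⟩
    by_cases hj : j = i
    · subst hj
      rw [Function.update_self]
      by_contra hlt
      have hj := withTop_eq_intCast_iff.2 ⟨hh'.2 j, hlt⟩
      -- An element of value exactly `α j` may vanish on other branches. Making those values finite
      -- but at least `M` yields a point of the value set that is still above `α`.
      obtain ⟨M, hM⟩ := (Set.finite_range α).bddAbove
      obtain ⟨β, hβ, hβ'⟩ := hw.exists_finite_values hN hh'.1 M
      refine hc ⟨β, hβ, fun k => ?_, ?_⟩
      · rcases hβ' k with h1 | ⟨-, h1⟩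
        · have := hh'.2 k
          rwa [h1, WithTop.coe_le_coe] at this
        · exact (hM ⟨k, rfl⟩ : α k ≤ M).trans h1
      · rcases hβ' j with h1 | ⟨h1, -⟩
        · rw [hj, WithTop.coe_eq_coe] at h1
          exact h1.symm
        · rw [hj] at h1
          exact absurd h1 WithTop.coe_ne_top
    · rw [Function.update_of_ne hj]
      exact hh'.2 j

end IsValuationFamily
end AdmissibleRing

end

/-! ### Corners of planar staircases. -/

section

namespace AdmissibleRing

section Staircase

variable {Q : ℤ → ℤ → Prop} {a b : ℤ}

/-- The first coordinates of the steps of the staircase below a planar set. -/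
def steps (Q : ℤ → ℤ → Prop) : Set ℤ :=
  {x | ∃ y, Q x y ∧ ∀ x' y', Q x' y' → x < x' → y' < y}

/-- The maximal points of a planar set, for the product order. -/
def outerCorners (Q : ℤ → ℤ → Prop) : Set (ℤ × ℤ) :=
  {z | Q z.1 z.2 ∧ ∀ x' y', Q x' y' → z.1 ≤ x' → z.2 ≤ y' → x' = z.1 ∧ y' = z.2}

/-- The reentrant corners of the staircase below a planar set. -/
def innerCorners (Q : ℤ → ℤ → Prop) : Set (ℤ × ℤ) :=
  {z | Q z.1 z.2 ∧ (∀ x' y', Q x' y' → z.1 < x' → y' ≤ z.2) ∧ (∃ y', z.2 < y' ∧ Q z.1 y') ∧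
    ∃ x', z.1 < x' ∧ Q x' z.2}

theorem exists_greatest_of_lt {S : ℤ → Prop} {x b : ℤ} (hx : S x) (hb : ∀ z, S z → z < b) :
    ∃ m, S m ∧ ∀ z, S z → z ≤ m := by
  obtain ⟨m, hm, hm'⟩ := Int.exists_greatest_of_bdd (P := S) ⟨b, fun z hz => (hb z hz).le⟩ ⟨x, hx⟩
  exact ⟨m, hm, hm'⟩

theorem innerCorners_injOn : Set.InjOn Prod.fst (innerCorners Q) := by
  have key : ∀ x y y', (x, y) ∈ innerCorners Q → (x, y') ∈ innerCorners Q → y' ≤ y := by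
    rintro x y y' ⟨-, h, -⟩ ⟨-, -, -, x', hx', hQ⟩
    exact h x' y' hQ hx'
  rintro ⟨x, y⟩ h ⟨x', y'⟩ h' (rfl : x = x')
  rw [le_antisymm (key x y' y h' h) (key x y y' h h')]

theorem outerCorners_injOn : Set.InjOn Prod.fst (outerCorners Q) := by
  rintro ⟨x, y⟩ h ⟨x', y'⟩ h' (rfl : x = x')
  rcases le_total y y' with hy | hy
  · rw [(h.2 x y' h'.1 le_rfl hy).2]
  · rw [(h'.2 x y h.1 le_rfl hy).2]

/-- Every step except a last one carries an inner corner. Its height is the greatest one attained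
strictly to the right, and closure under infima puts the corner itself into `Q`. -/
theorem image_fst_innerCorners (hinf : ∀ x y x' y', Q x y → Q x' y' → Q (min x x') (min y y')) :
    Prod.fst '' innerCorners Q = {x ∈ steps Q | ∃ x' y', x < x' ∧ Q x' y'} := by
  ext x
  constructor
  · rintro ⟨⟨x, y⟩, ⟨-, h, ⟨y', hy', hQ⟩, x', hx', hQ'⟩, rfl⟩
    exact ⟨⟨y', hQ, fun x'' y'' hQ'' hx'' => lt_of_le_of_lt (h x'' y'' hQ'' hx'') hy'⟩,
      x', y, hx', hQ'⟩
  · rintro ⟨⟨y, hQ, hy⟩, x', y', hx', hQ'⟩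
    obtain ⟨m, ⟨x'', hx'', hm⟩, hmax⟩ := exists_greatest_of_lt
      (S := fun z => ∃ x'', x < x'' ∧ Q x'' z) ⟨x', hx', hQ'⟩
      (fun z ⟨x'', hx'', hz⟩ => hy x'' z hz hx'')
    have hmy := hy x'' m hm hx''
    refine ⟨(x, m), ⟨?_, fun u v huv hu => hmax v ⟨u, hu, huv⟩, ⟨y, hmy, hQ⟩, x'', hx'', hm⟩, rfl⟩
    have := hinf _ _ _ _ hQ hm
    rwa [min_eq_left hx''.le, min_eq_right hmy.le] at this

/-- A step carries an outer corner at the top of its column unless the column is unbounded, that is,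
unless it reaches height `b`. -/
theorem image_fst_outerCorners (hb : ∀ x y, Q x y → b ≤ y → ∀ y', b ≤ y' → Q x y') :
    Prod.fst '' outerCorners Q = {x ∈ steps Q | ¬ ∃ y, b ≤ y ∧ Q x y} := by
  ext x
  constructor
  · rintro ⟨⟨x, y⟩, ⟨hQ, h⟩, rfl⟩
    refine ⟨⟨y, hQ, fun x' y' hQ' hx' => ?_⟩, ?_⟩
    · by_contra! hy
      have := (h x' y' hQ' hx'.le hy).1
      omega
    · rintro ⟨y', hy', hQ'⟩
      have hQ'' := hb x y' hQ' hy' (max b (y + 1)) (le_max_left _ _)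
      have := (h x _ hQ'' le_rfl (by simp only; omega)).2
      simp only at this
      omega
  · rintro ⟨⟨y, hQ, hy⟩, hno⟩
    obtain ⟨m, hm, hmax⟩ := exists_greatest_of_lt (S := fun z => Q x z) (b := b) hQ
      (fun z hz => by
        by_contra! h
        exact hno ⟨z, h, hz⟩)
    refine ⟨(x, m), ⟨hm, fun x' y' hQ' hx' hy' => ?_⟩, rfl⟩
    simp only at hx' hy' ⊢
    have hxx : x' = x := by
      by_contra hne
      have := hy x' y' hQ' (by omega)
      have := hmax y hQ
      omega
    subst hxx
    exact ⟨rfl, le_antisymm (hmax y' hQ') hy'⟩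

theorem lt_of_mem_steps (ha : ∀ x y, Q x y → a ≤ x → ∀ x', a ≤ x' → Q x' y) {x : ℤ}
    (hx : x ∈ steps Q) : x < a := by
  obtain ⟨y, hQ, hy⟩ := hx
  by_contra! h
  have := hy (x + 1) y (ha x y hQ h _ (by omega)) (by omega)
  omega

theorem finite_steps (hlow : ∃ l, ∀ x y, Q x y → l ≤ x)
    (ha : ∀ x y, Q x y → a ≤ x → ∀ x', a ≤ x' → Q x' y) : (steps Q).Finite := by
  obtain ⟨l, hl⟩ := hlow
  refine (Set.finite_Ico l a).subset fun x hx => ⟨?_, lt_of_mem_steps ha hx⟩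
  obtain ⟨y, hQ, -⟩ := hx
  exact hl x y hQ

open Classical in
theorem ncard_steps_not_exists_gt (hne : ∃ x y, Q x y)
    (ha : ∀ x y, Q x y → a ≤ x → ∀ x', a ≤ x' → Q x' y) :
    {x ∈ steps Q | ¬ ∃ x' y', x < x' ∧ Q x' y'}.ncard +
      (if ∃ x y, a ≤ x ∧ Q x y then 1 else 0) = 1 := by
  split_ifs with hA
  · obtain ⟨x, y, hx, hQ⟩ := hA
    suffices h : {x ∈ steps Q | ¬ ∃ x' y', x < x' ∧ Q x' y'} = ∅ by rw [h, Set.ncard_empty]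
    rw [Set.eq_empty_iff_forall_notMem]
    rintro x' ⟨hx', hno⟩
    exact hno ⟨x, y, (lt_of_mem_steps ha hx').trans_le hx, hQ⟩
  · obtain ⟨x, y, hQ⟩ := hne
    obtain ⟨m, ⟨y', hm⟩, hmax⟩ := exists_greatest_of_lt (S := fun z => ∃ y, Q z y) (b := a) ⟨y, hQ⟩
      (fun z ⟨y, hz⟩ => by
        by_contra! h
        exact hA ⟨z, y, h, hz⟩)
    rw [add_zero, Set.ncard_eq_one]
    refine ⟨m, Set.eq_singleton_iff_unique_mem.2 ⟨⟨⟨y', hm, fun x' y'' hQ' hx' => ?_⟩, ?_⟩, ?_⟩⟩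
    · have := hmax x' ⟨y'', hQ'⟩
      omega
    · rintro ⟨x', y'', hx', hQ'⟩
      have := hmax x' ⟨y'', hQ'⟩
      omega
    · rintro x' ⟨⟨y'', hQ', -⟩, hno⟩
      refine le_antisymm (hmax x' ⟨y'', hQ'⟩) ?_
      by_contra! h
      exact hno ⟨m, y', h, hm⟩

-- Only the rightmost column reaching height `b` can be an unbounded step; `hab` guarantees that
-- such columns stay left of `a`.
open Classical in
theorem ncard_steps_exists_ge (hb : ∀ x y, Q x y → b ≤ y → ∀ y', b ≤ y' → Q x y')
    (hab : ¬ ∃ x y, a ≤ x ∧ b ≤ y ∧ Q x y) :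
    {x ∈ steps Q | ∃ y, b ≤ y ∧ Q x y}.ncard = if ∃ x y, b ≤ y ∧ Q x y then 1 else 0 := by
  split_ifs with hB
  · obtain ⟨x, y, hy, hQ⟩ := hB
    obtain ⟨m, ⟨y', hy', hm⟩, hmax⟩ := exists_greatest_of_lt
      (S := fun z => ∃ y, b ≤ y ∧ Q z y) (b := a) ⟨y, hy, hQ⟩
      (fun z ⟨y, hy, hz⟩ => by
        by_contra! h
        exact hab ⟨z, y, h, hy, hz⟩)
    rw [Set.ncard_eq_one]
    refine ⟨m, Set.eq_singleton_iff_unique_mem.2 ⟨⟨⟨y', hm, fun x' y'' hQ' hx' => ?_⟩, y', hy', hm⟩,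
      ?_⟩⟩
    · by_contra! h
      have := hmax x' ⟨y'', hy'.trans h, hQ'⟩
      omega
    · rintro x' ⟨⟨y₁, hQ₁, hstep⟩, y₂, hy₂, hQ₂⟩
      refine le_antisymm (hmax x' ⟨y₂, hy₂, hQ₂⟩) ?_
      by_contra! h
      have := hstep m (max b y₁) (hb m y' hm hy' _ (le_max_left _ _)) h
      omega
  · suffices h : {x ∈ steps Q | ∃ y, b ≤ y ∧ Q x y} = ∅ by rw [h, Set.ncard_empty]
    rw [Set.eq_empty_iff_forall_notMem]
    rintro x ⟨-, y, hy, hQ⟩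
    exact hB ⟨x, y, hy, hQ⟩

theorem ncard_sep_add_ncard_sep_not {α : Type*} {S : Set α} (hS : S.Finite) (p : α → Prop) :
    {x ∈ S | p x}.ncard + {x ∈ S | ¬ p x}.ncard = S.ncard := by
  have h := Set.ncard_inter_add_ncard_sdiff_eq_ncard S {x | p x} hS
  exact h

theorem finite_corners (hinf : ∀ x y x' y', Q x y → Q x' y' → Q (min x x') (min y y'))
    (hlow : ∃ l, ∀ x y, Q x y → l ≤ x)
    (ha : ∀ x y, Q x y → a ≤ x → ∀ x', a ≤ x' → Q x' y)
    (hb : ∀ x y, Q x y → b ≤ y → ∀ y', b ≤ y' → Q x y') :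
    (innerCorners Q).Finite ∧ (outerCorners Q).Finite := by
  have hfin := finite_steps hlow ha
  constructor
  · refine Set.Finite.of_finite_image ?_ innerCorners_injOn
    rw [image_fst_innerCorners hinf]
    exact hfin.subset (Set.sep_subset _ _)
  · refine Set.Finite.of_finite_image ?_ outerCorners_injOn
    rw [image_fst_outerCorners hb]
    exact hfin.subset (Set.sep_subset _ _)

open Classical in
/-- In a bounded staircase there is one outer corner more than there are inner ones, unless the
staircase is unbounded to the right or upwards. -/
theorem ncard_innerCorners_add (hinf : ∀ x y x' y', Q x y → Q x' y' → Q (min x x') (min y y'))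
    (hlow : ∃ l, ∀ x y, Q x y → l ≤ x) (hne : ∃ x y, Q x y)
    (ha : ∀ x y, Q x y → a ≤ x → ∀ x', a ≤ x' → Q x' y)
    (hb : ∀ x y, Q x y → b ≤ y → ∀ y', b ≤ y' → Q x y')
    (hab : ¬ ∃ x y, a ≤ x ∧ b ≤ y ∧ Q x y) :
    (innerCorners Q).ncard + (if ∃ x y, a ≤ x ∧ Q x y then 0 else 1) +
      (if ∃ x y, b ≤ y ∧ Q x y then 0 else 1) = (outerCorners Q).ncard + 1 := by
  have hfin := finite_steps hlow ha
  -- Count the steps twice. Inner corners miss one step exactly when the staircase is bounded on the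
  -- right; outer corners miss one exactly when it is unbounded upwards.
  have h1 := ncard_sep_add_ncard_sep_not hfin fun x => ∃ x' y', x < x' ∧ Q x' y'
  have h2 := ncard_sep_add_ncard_sep_not hfin fun x => ∃ y, b ≤ y ∧ Q x y
  have h3 := ncard_steps_not_exists_gt hne ha
  have h4 := ncard_steps_exists_ge hb hab
  rw [← image_fst_innerCorners hinf, Set.InjOn.ncard_image innerCorners_injOn] at h1
  rw [← image_fst_outerCorners hb, Set.InjOn.ncard_image outerCorners_injOn] at h2
  split_ifs at h3 h4 ⊢ <;> omega

end Staircase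
end AdmissibleRing

end

/-! ### Good sets: least element, conductor and projections to pairs of coordinates. -/

section

namespace AdmissibleRing

section

variable {ι : Type*}

theorem exists_isLeast_of_inf_mem [Finite ι] {S : Set (ι → ℤ)} (hne : S.Nonempty)
    (hbdd : BddBelow S) (hinf : ∀ α ∈ S, ∀ β ∈ S, α ⊓ β ∈ S) : ∃ α, IsLeast S α := by
  classical
  have := Fintype.ofFinite ι
  obtain ⟨l, hl⟩ := hbdd
  obtain ⟨σ, hσ⟩ := hne
  have hmin : ∀ i, ∃ α ∈ S, ∀ β ∈ S, α i ≤ β i := by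
    intro i
    obtain ⟨m, ⟨α, hα, rfl⟩, hm⟩ := Int.exists_least_of_bdd (P := fun z => ∃ α ∈ S, α i = z)
      ⟨l i, fun z ⟨α, hα, hz⟩ => hz ▸ hl hα i⟩ ⟨σ i, σ, hσ, rfl⟩
    exact ⟨α, hα, fun β hβ => hm _ ⟨β, hβ, rfl⟩⟩
  choose f hf hf' using hmin
  have key : ∀ s : Finset ι, ∃ α ∈ S, ∀ i ∈ s, ∀ β ∈ S, α i ≤ β i := by
    intro s
    induction s using Finset.induction_on with
    | empty => exact ⟨σ, hσ, by simp⟩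
    | insert i s _ ih =>
      obtain ⟨α, hα, h⟩ := ih
      refine ⟨f i ⊓ α, hinf _ (hf i) _ hα, fun j hj β hβ => ?_⟩
      rcases Finset.mem_insert.1 hj with rfl | hj
      · exact (min_le_left _ _).trans (hf' j β hβ)
      · exact (min_le_right _ _).trans (h j hj β hβ)
  obtain ⟨α, hα, h⟩ := key Finset.univ
  exact ⟨α, hα, fun β hβ i => h i (Finset.mem_univ i) β hβ⟩

namespace IsGoodSet

variable {E : Set (ι → ℤ)}

theorem exists_isLeast [Finite ι] (hE : IsGoodSet E) : ∃ α, IsLeast E α := by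
  obtain ⟨δ, hδ⟩ := hE.exists_Ici_subset
  exact exists_isLeast_of_inf_mem ⟨δ, hδ Set.self_mem_Ici⟩ hE.bddBelow hE.inf_mem

theorem exists_isConductor [Finite ι] (hE : IsGoodSet E) : ∃ c, IsConductor E c := by
  obtain ⟨l, hl⟩ := hE.bddBelow
  refine exists_isLeast_of_inf_mem hE.exists_Ici_subset
    ⟨l, fun δ hδ => hl (hδ Set.self_mem_Ici)⟩ fun δ hδ δ' hδ' β hβ => ?_
  -- A point above `δ ⊓ δ'` is the infimum of a point above `δ` and a point above `δ'`.
  have : β = (β ⊔ δ) ⊓ (β ⊔ δ') := by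
    rw [← sup_inf_left, sup_eq_left.2 (Set.mem_Ici.1 hβ)]
  rw [this]
  exact hE.inf_mem _ (hδ (Set.mem_Ici.2 le_sup_right)) _
    (hδ' (Set.mem_Ici.2 le_sup_right))

variable [DecidableEq ι] {γ : ι → ℤ}

/-- Beyond `γ` a coordinate can be moved freely. It is pushed up by repeated exchange against points
of the orthant at `γ`, and cut down to `m` by an infimum with such a point. -/
theorem update_mem (hE : IsGoodSet E) (hγ : Set.Ici γ ⊆ E) {α : ι → ℤ} (hα : α ∈ E) {i : ι}
    (hi : γ i ≤ α i) {m : ℤ} (hm : γ i ≤ m) : Function.update α i m ∈ E := by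
  have hup : ∀ k : ℕ, ∃ ε ∈ E, α i + k ≤ ε i ∧ ∀ j ≠ i, ε j = α j := by
    intro k
    induction k with
    | zero => exact ⟨α, hα, by simp, fun _ _ => rfl⟩
    | succ k ih =>
      obtain ⟨ε, hε, h1, h2⟩ := ih
      obtain ⟨ε', hε', h3, h4⟩ := hE.exchange ε hε
        -- This point agrees with `ε` at `i` and is strictly larger elsewhere, so exchange raises
        -- coordinate `i` and keeps all the others.
        (fun j => if j = i then ε i else max (γ j) (ε j) + 1)
        (hγ fun j => by
          by_cases hj : j = i
          · subst hj; simp only [if_true]; omega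
          · simp only [if_neg hj]; omega) i (by simp)
      refine ⟨ε', hε', by push_cast; omega, fun j hj => ?_⟩
      have h5 := (h4 j).2
      simp only [if_neg hj] at h5
      rw [h5 (by omega), ← h2 j hj]
      omega
  obtain ⟨ε, hε, h1, h2⟩ := hup (m - α i).toNat
  have := hE.inf_mem ε hε (fun j => if j = i then m else max (γ j) (ε j)) (hγ fun j => by
    by_cases hj : j = i
    · subst hj; simpa using hm
    · simp [hj])
  convert this using 1
  ext j
  by_cases hj : j = i
  · subst hj
    simp only [Function.update_self, Pi.inf_apply, if_true]
    exact (min_eq_right (by omega)).symm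
  · simp only [Function.update_of_ne hj, Pi.inf_apply, if_neg hj, h2 j hj]
    exact (min_eq_left (le_max_right _ _)).symm

/-- The maximal points of the projection to two coordinates correspond to the values in the second
one that are attained, but not with an arbitrarily large first coordinate. -/
theorem maximals_restrict_pair (hE : IsGoodSet E) (hγ : Set.Ici γ ⊆ E) {i j : ι} (hij : i ≠ j) :
    (maximals {β : ({i, j} : Finset ι) → ℤ | ∃ α ∈ E, ∀ k, β k = α k}).Finite ∧
    (maximals {β : ({i, j} : Finset ι) → ℤ | ∃ α ∈ E, ∀ k, β k = α k}).ncard =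
      {n | (∃ β ∈ E, β j = n) ∧ ¬ ∃ β ∈ E, β j = n ∧ γ i ≤ β i}.ncard := by
  set F := {β : ({i, j} : Finset ι) → ℤ | ∃ α ∈ E, ∀ k, β k = α k} with hF
  let i' : ({i, j} : Finset ι) := ⟨i, by simp⟩
  let j' : ({i, j} : Finset ι) := ⟨j, by simp⟩
  have hij' : i' ≠ j' := fun h => hij (congrArg Subtype.val h)
  have hcases : ∀ k : ({i, j} : Finset ι), k = i' ∨ k = j' := by
    rintro ⟨k, hk⟩
    rcases Finset.mem_insert.1 hk with rfl | hk
    · exact Or.inl rfl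
    · exact Or.inr (Subtype.ext (Finset.mem_singleton.1 hk))
  have hmax : ∀ β : ({i, j} : Finset ι) → ℤ, β ∈ maximals F ↔
      (∃ α ∈ E, α i = β i' ∧ α j = β j') ∧ (¬ ∃ α ∈ E, α i = β i' ∧ β j' < α j) ∧
        ¬ ∃ α ∈ E, α j = β j' ∧ β i' < α i := by
    intro β
    constructor
    · rintro ⟨⟨α, hα, hβ⟩, h⟩
      refine ⟨⟨α, hα, (hβ i').symm, (hβ j').symm⟩, ?_, ?_⟩
      · rintro ⟨α', hα', h1, h2⟩
        refine Set.notMem_empty (fun k : ({i, j} : Finset ι) => α' k)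
          (h i' ▸ ⟨⟨α', hα', fun _ => rfl⟩, ?_, ?_⟩)
        · intro k hk
          rw [Finset.mem_singleton] at hk
          subst hk
          exact h1
        · intro k hk
          rw [Finset.mem_singleton] at hk
          obtain rfl := (hcases k).resolve_left hk
          exact h2
      · rintro ⟨α', hα', h1, h2⟩
        refine Set.notMem_empty (fun k : ({i, j} : Finset ι) => α' k)
          (h j' ▸ ⟨⟨α', hα', fun _ => rfl⟩, ?_, ?_⟩)
        · intro k hk
          rw [Finset.mem_singleton] at hk
          subst hk
          exact h1
        · intro k hk
          rw [Finset.mem_singleton] at hk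
          obtain rfl := (hcases k).resolve_right hk
          exact h2
    · rintro ⟨⟨α, hα, h1, h2⟩, h3, h4⟩
      refine ⟨⟨α, hα, fun k => ?_⟩, fun k => ?_⟩
      · rcases hcases k with rfl | rfl
        · exact h1.symm
        · exact h2.symm
      · rw [Set.eq_empty_iff_forall_notMem]
        rintro β' ⟨⟨α', hα', h5⟩, h6, h7⟩
        rcases hcases k with rfl | rfl
        · refine h3 ⟨α', hα', ?_, ?_⟩
          · rw [← h6 i' (by simp), h5 i']
          · have := h7 j' (by simpa using hij'.symm)
            rwa [h5 j'] at this
        · refine h4 ⟨α', hα', ?_, ?_⟩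
          · rw [← h6 j' (by simp), h5 j']
          · have := h7 i' (by simpa using hij')
            rwa [h5 i'] at this
  have hinj : Set.InjOn (fun β : ({i, j} : Finset ι) → ℤ => β j') (maximals F) := by
    intro β hβ β' hβ' (h : β j' = β' j')
    rw [hmax] at hβ hβ'
    obtain ⟨⟨α, hα, h1, h2⟩, -, h3⟩ := hβ
    obtain ⟨⟨α', hα', h1', h2'⟩, -, h3'⟩ := hβ'
    have hi : β i' = β' i' := by
      rcases lt_trichotomy (β i') (β' i') with hlt | heq | hgt
      · exact absurd ⟨α', hα', by omega, by omega⟩ h3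
      · exact heq
      · exact absurd ⟨α, hα, by omega, by omega⟩ h3'
    ext k
    rcases hcases k with rfl | rfl
    · exact hi
    · exact h
  have himg : (fun β : ({i, j} : Finset ι) → ℤ => β j') '' maximals F =
      {n | (∃ β ∈ E, β j = n) ∧ ¬ ∃ β ∈ E, β j = n ∧ γ i ≤ β i} := by
    ext n
    constructor
    · rintro ⟨β, hβ, rfl⟩
      rw [hmax] at hβ
      obtain ⟨⟨α, hα, h1, h2⟩, h3, h4⟩ := hβ
      refine ⟨⟨α, hα, h2⟩, ?_⟩
      rintro ⟨α', hα', h5, h6⟩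
      have h7 : γ i ≤ β i' := by
        by_contra! h
        exact h4 ⟨α', hα', h5, by omega⟩
      -- Were the value attained beyond `γ i`, maximality would force `γ i ≤ β i'`. The orthant at
      -- `γ` then contains a point with the same `i`-th and a larger `j`-th coordinate.
      refine h3 ⟨fun k => if k = i then β i' else max (γ k) (α j) + 1, hγ fun k => ?_, by simp, ?_⟩
      · by_cases hk : k = i
        · subst hk; simpa using h7
        · simp only [if_neg hk]; omega
      · simp only [if_neg hij.symm]
        omega
    · rintro ⟨⟨β, hβ, hβn⟩, hno⟩
      -- The maximal over `n` has the greatest possible `i`-th coordinate. A point with that `i`-th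
      -- coordinate and a larger `j`-th one would, by exchange at `i`, produce a still greater
      -- coordinate over `n`.
      obtain ⟨m, ⟨α, hα, h1, h2⟩, hm⟩ := exists_greatest_of_lt
        (S := fun z => ∃ α ∈ E, α j = n ∧ α i = z) (b := γ i) ⟨β, hβ, hβn, rfl⟩
        (fun z ⟨α, hα, h1, h2⟩ => by
          by_contra! h
          exact hno ⟨α, hα, h1, by omega⟩)
      refine ⟨fun k => α k, (hmax _).2 ⟨⟨α, hα, rfl, rfl⟩, ?_, ?_⟩, h1⟩
      · rintro ⟨α', hα', h3, h4⟩
        change α' i = α i at h3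
        change α j < α' j at h4
        obtain ⟨ε, hε, h5, h6⟩ := hE.exchange α hα α' hα' i h3.symm
        have h7 := (h6 j).2 (by omega)
        have := hm (ε i) ⟨ε, hε, by omega, rfl⟩
        omega
      · rintro ⟨α', hα', h3, h4⟩
        change α' j = α j at h3
        change α i < α' i at h4
        have := hm (α' i) ⟨α', hα', by omega, rfl⟩
        omega
  have hfin : {n | (∃ β ∈ E, β j = n) ∧ ¬ ∃ β ∈ E, β j = n ∧ γ i ≤ β i}.Finite := by
    obtain ⟨l, hl⟩ := hE.bddBelow
    refine (Set.finite_Ico (l j) (γ j)).subset ?_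
    rintro n ⟨⟨β, hβ, rfl⟩, hno⟩
    refine ⟨hl hβ j, ?_⟩
    by_contra! h
    refine hno ⟨Function.update γ j (β j), hγ fun k => ?_, by simp, by simp [hij]⟩
    by_cases hk : k = j
    · subst hk; simpa using h
    · simp [hk]
  rw [← himg] at hfin ⊢
  exact ⟨hfin.of_finite_image hinj, hinj.ncard_image.symm⟩

end IsGoodSet
end
end AdmissibleRing

end

/-! ### Lengths along an axis, and slices of good sets of triples. -/

section

namespace AdmissibleRing

open Classical in
theorem length_path {ι : Type*} [DecidableEq ι] {E : Set (ι → ℤ)} {L : (ι → ℤ) → ℕ∞}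
    (hL : ∀ α i, L (Function.update α i (α i + 1)) =
      L α + if ∃ β ∈ E, α ≤ β ∧ β i = α i then 1 else 0) (α : ι → ℤ) (i : ι) {b : ℤ}
    (hb : α i ≤ b) :
    L (Function.update α i b) =
      L α + ({n | n ∈ Set.Ico (α i) b ∧ ∃ β ∈ E, β i = n ∧ ∀ j ≠ i, α j ≤ β j}.ncard : ℕ∞) := by
  obtain ⟨k, rfl⟩ : ∃ k : ℕ, b = α i + k := ⟨(b - α i).toNat, by omega⟩
  clear hb
  induction k with
  | zero => simp
  | succ k ih =>
    have hstep := hL (Function.update α i (α i + k)) i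
    simp only [Function.update_self, Function.update_idem] at hstep
    have hcond : (∃ β ∈ E, Function.update α i (α i + k) ≤ β ∧ β i = α i + k) ↔
        ∃ β ∈ E, β i = α i + k ∧ ∀ j ≠ i, α j ≤ β j := by
      refine exists_congr fun β => and_congr_right fun _ => ?_
      rw [and_comm]
      refine and_congr_right fun hβ => ?_
      rw [update_le_iff]
      exact ⟨fun h => h.2, fun h => ⟨hβ.ge, h⟩⟩
    rw [Nat.cast_succ, ← add_assoc, hstep, ih, add_assoc]
    congr 1
    set S := fun b : ℤ => {n | n ∈ Set.Ico (α i) b ∧ ∃ β ∈ E, β i = n ∧ ∀ j ≠ i, α j ≤ β j}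
    have hfin : ∀ b, (S b).Finite := fun b => (Set.finite_Ico (α i) b).subset fun n hn => hn.1
    change ((S (α i + k)).ncard : ℕ∞) + _ = ((S (α i + k + 1)).ncard : ℕ∞)
    split_ifs with hc
    · have : S (α i + k + 1) = insert (α i + k) (S (α i + k)) := by
        ext n
        simp only [S, Set.mem_ofPred_eq, Set.mem_insert_iff, Set.mem_Ico]
        constructor
        · rintro ⟨⟨h1, h2⟩, h3⟩
          rcases eq_or_ne n (α i + k) with h | h
          · exact Or.inl h
          · exact Or.inr ⟨⟨h1, by omega⟩, h3⟩
        · rintro (rfl | ⟨⟨h1, h2⟩, h3⟩)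
          · exact ⟨⟨by omega, by omega⟩, hcond.1 hc⟩
          · exact ⟨⟨h1, by omega⟩, h3⟩
      rw [this, Set.ncard_insert_of_notMem (fun h => by simpa using h.1.2) (hfin _)]
      push_cast
      rfl
    · have : S (α i + k + 1) = S (α i + k) := by
        ext n
        simp only [S, Set.mem_ofPred_eq, Set.mem_Ico]
        constructor
        · rintro ⟨⟨h1, h2⟩, h3⟩
          refine ⟨⟨h1, ?_⟩, h3⟩
          have : n ≠ α i + k := by
            rintro rfl
            exact hc (hcond.2 h3)
          omega
        · rintro ⟨⟨h1, h2⟩, h3⟩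
          exact ⟨⟨h1, by omega⟩, h3⟩
      rw [this, add_zero]

theorem ncard_mem_Ico_add_ncard_gaps {A : Set ℤ} {a b : ℤ} (ha : IsLeast A a)
    (hb : Set.Ici b ⊆ A) (hab : a ≤ b) :
    (gaps A).Finite ∧ ({n | n ∈ Set.Ico a b ∧ n ∈ A}.ncard : ℤ) = b - a - (gaps A).ncard := by
  have hgaps : gaps A = {n | n ∈ Set.Ico a b ∧ n ∉ A} := by
    ext n
    constructor
    · rintro ⟨h1, m, hm, hmn⟩
      refine ⟨⟨(ha.2 hm).trans hmn.le, ?_⟩, h1⟩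
      by_contra! h
      exact h1 (hb h)
    · rintro ⟨⟨h1, h2⟩, h3⟩
      refine ⟨h3, a, ha.1, lt_of_le_of_ne h1 ?_⟩
      rintro rfl
      exact h3 ha.1
  have hfin : (Set.Ico a b).Finite := Set.finite_Ico a b
  have h := ncard_sep_add_ncard_sep_not hfin (· ∈ A)
  refine ⟨hgaps ▸ hfin.subset fun n hn => hn.1, ?_⟩
  rw [hgaps]
  have hcard : ((Set.Ico a b).ncard : ℤ) = b - a := by
    rw [← Finset.coe_Ico, Set.ncard_coe_finset, Int.card_Ico]
    omega
  rw [← hcard, ← h]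
  push_cast
  change ({x | x ∈ Set.Ico a b ∧ x ∈ A}.ncard : ℤ) = ({x | x ∈ Set.Ico a b ∧ x ∈ A}.ncard : ℤ) +
    ({x | x ∈ Set.Ico a b ∧ x ∉ A}.ncard : ℤ) - ({x | x ∈ Set.Ico a b ∧ x ∉ A}.ncard : ℤ)
  ring

/-- The slice of a set of triples at height `n`. -/
def slice (E : Set (Fin 3 → ℤ)) (n x y : ℤ) : Prop := ![x, y, n] ∈ E

theorem eq_vec_three (α : Fin 3 → ℤ) : ![α 0, α 1, α 2] = α := by
  ext i
  fin_cases i <;> rfl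

section Slices

variable {E : Set (Fin 3 → ℤ)}

theorem slice_of_mem {β : Fin 3 → ℤ} (hβ : β ∈ E) {n : ℤ} (hn : β 2 = n) :
    slice E n (β 0) (β 1) := by
  rw [slice, ← hn, eq_vec_three]
  exact hβ

/-- Fibers with `2 ∈ J` are visibly conditions on the slice. For other `J`, exchanging `α` with a
point of the fiber at some `j ∈ J` gives a point at height `α 2` that contradicts the outer corner.
-/
theorem mem_absoluteMaximals_iff (hE : IsGoodSet E) (α : Fin 3 → ℤ) :
    α ∈ absoluteMaximals E ↔ (α 0, α 1) ∈ outerCorners (slice E (α 2)) := by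
  constructor
  · rintro ⟨⟨hα, -⟩, h⟩
    refine ⟨slice_of_mem hα rfl, fun x' y' hQ hx hy => ?_⟩
    simp only at hx hy ⊢
    by_contra hne
    rcases hx.eq_or_lt with hx | hx
    · have hy : α 1 < y' := lt_of_le_of_ne hy fun h => hne ⟨hx.symm, h.symm⟩
      refine Set.notMem_empty ![x', y', α 2] (h {0, 2} (by simp) (by decide) ▸ ⟨hQ, ?_, ?_⟩) <;>
      · intro j
        fin_cases j <;> simp [hx, hy]
    · rcases hy.eq_or_lt with hy | hy
      · refine Set.notMem_empty ![x', y', α 2] (h {1, 2} (by simp) (by decide) ▸ ⟨hQ, ?_, ?_⟩) <;>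
        · intro j
          fin_cases j <;> simp [hx, hy]
      · refine Set.notMem_empty ![x', y', α 2] (h {2} (by simp) (by decide) ▸ ⟨hQ, ?_, ?_⟩) <;>
        · intro j
          fin_cases j <;> simp [hx, hy]
  · rintro ⟨hQ, h⟩
    simp only at hQ h
    have hα : α ∈ E := by
      rwa [slice, eq_vec_three] at hQ
    have key : ∀ J : Finset (Fin 3), J.Nonempty → J ≠ Finset.univ → fiber J E α = ∅ := by
      intro J hJ hJ'
      rw [Set.eq_empty_iff_forall_notMem]
      rintro β ⟨hβ, h1, h2⟩
      have hle : ∀ j, α j ≤ β j := fun j => by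
        by_cases hj : j ∈ J
        exacts [(h1 j hj).ge, (h2 j hj).le]
      by_cases hJ2 : (2 : Fin 3) ∈ J
      · obtain ⟨h3, h4⟩ := h _ _ (slice_of_mem hβ (h1 2 hJ2)) (hle 0) (hle 1)
        obtain ⟨j, hj⟩ : ∃ j, j ∉ J := by
          by_contra! hall
          exact hJ' (Finset.eq_univ_iff_forall.2 hall)
        have h5 := h2 j hj
        fin_cases j
        · exact h5.ne' h3
        · exact h5.ne' h4
        · exact hj hJ2
      · obtain ⟨j, hj⟩ := hJ
        obtain ⟨ε, hε, h3, h4⟩ := hE.exchange α hα β hβ j (h1 j hj).symm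
        have h5 := h2 2 hJ2
        have h6 := (h4 2).2 h5.ne
        rw [min_eq_left h5.le] at h6
        have h7 : ∀ k, α k ≤ ε k := fun k => (le_min le_rfl (hle k)).trans (h4 k).1
        obtain ⟨h8, h9⟩ := h _ _ (slice_of_mem hε h6) (h7 0) (h7 1)
        fin_cases j
        · exact h3.ne' h8
        · exact h3.ne' h9
        · exact hJ2 hj
    exact ⟨⟨hα, fun i => key {i} (by simp) (by revert i; decide)⟩, key⟩

/-- The conditions with `2 ∈ J` can be read off the slice. The remaining ones follow by exchange
with the two arms of the inner corner, the points `(α 0, y', α 2)` and `(x', α 1, α 2)`. -/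
theorem mem_relativeMaximals_iff (hE : IsGoodSet E) (α : Fin 3 → ℤ) :
    α ∈ relativeMaximals E ↔ (α 0, α 1) ∈ innerCorners (slice E (α 2)) := by
  constructor
  · rintro ⟨⟨hα, h⟩, h'⟩
    refine ⟨slice_of_mem hα rfl, fun x' y' hQ hx => ?_, ?_, ?_⟩
    · simp only at hx ⊢
      by_contra! hy
      refine Set.notMem_empty ![x', y', α 2] (h 2 ▸ ⟨hQ, ?_, ?_⟩) <;>
      · intro j
        fin_cases j <;> simp [hx, hy]
    · obtain ⟨β, hβ, h1, h2⟩ := h' {0, 2} (by decide)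
      refine ⟨β 1, h2 1 (by decide), ?_⟩
      have := slice_of_mem hβ (h1 2 (by decide))
      rwa [h1 0 (by decide)] at this
    · obtain ⟨β, hβ, h1, h2⟩ := h' {1, 2} (by decide)
      refine ⟨β 0, h2 0 (by decide), ?_⟩
      have := slice_of_mem hβ (h1 2 (by decide))
      rwa [h1 1 (by decide)] at this
  · rintro ⟨hQ, h, ⟨y', hy', hQy⟩, x', hx', hQx⟩
    simp only at hQ h hy' hQy hx' hQx
    have hα : α ∈ E := by
      rwa [slice, eq_vec_three] at hQ
    refine ⟨⟨hα, fun i => ?_⟩, fun J hJ => ?_⟩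
    · rw [Set.eq_empty_iff_forall_notMem]
      rintro β ⟨hβ, h1, h2⟩
      have hi := h1 i (by simp)
      fin_cases i
      · have hβ1 : α 1 < β 1 := h2 1 (by decide)
        have hβ2 : α 2 < β 2 := h2 2 (by decide)
        -- Exchange with the vertical arm at coordinate 0 returns to height `α 2`, strictly to the
        -- right of and above the inner corner.
        obtain ⟨ε, hε, h3, h4⟩ := hE.exchange _ hQy β hβ 0 hi.symm
        have h5 : min y' (β 1) ≤ ε 1 := (h4 1).1
        have h6 : ε 2 = min (α 2) (β 2) := (h4 2).2 hβ2.ne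
        have := h _ _ (slice_of_mem hε (h6.trans (min_eq_left hβ2.le))) h3
        omega
      · have hβ0 : α 0 < β 0 := h2 0 (by decide)
        have hβ2 : α 2 < β 2 := h2 2 (by decide)
        obtain ⟨ε, hε, h3, h4⟩ := hE.exchange _ hQx β hβ 1 hi.symm
        have h5 : min x' (β 0) ≤ ε 0 := (h4 0).1
        have h6 : ε 2 = min (α 2) (β 2) := (h4 2).2 hβ2.ne
        have := h _ _ (slice_of_mem hε (h6.trans (min_eq_left hβ2.le))) (by omega)
        have h3 : α 1 < ε 1 := h3
        omega
      · have := h _ _ (slice_of_mem hβ hi) (h2 0 (by decide))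
        have : α 1 < β 1 := h2 1 (by decide)
        omega
    · have hJ' : J = {0, 1} ∨ J = {0, 2} ∨ J = {1, 2} ∨ J = Finset.univ := by
        revert J
        decide
      rcases hJ' with rfl | rfl | rfl | rfl
      · obtain ⟨ε, hε, h3, h4⟩ := hE.exchange _ hQy _ hQx 2 rfl
        have h5 : ε 0 = min (α 0) x' := (h4 0).2 hx'.ne
        have h6 : ε 1 = min y' (α 1) := (h4 1).2 hy'.ne'
        have h3 : α 2 < ε 2 := h3
        refine ⟨ε, hε, ?_, ?_⟩ <;>
        · intro j
          fin_cases j <;> simp [h5, h6, hx'.le, hy'.le, h3]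
      · refine ⟨_, hQy, ?_, ?_⟩ <;>
        · intro j
          fin_cases j <;> simp [hy']
      · refine ⟨_, hQx, ?_, ?_⟩ <;>
        · intro j
          fin_cases j <;> simp [hx']
      · exact ⟨α, hα, fun _ _ => rfl, fun j hj => absurd (Finset.mem_univ j) hj⟩

theorem ncard_of_slices {X : Set (Fin 3 → ℤ)} {F : ℤ → Set (ℤ × ℤ)} {S : Finset ℤ}
    (hX : ∀ α, α ∈ X ↔ (α 0, α 1) ∈ F (α 2)) (hF : ∀ n ∉ S, F n = ∅) (hfin : ∀ n, (F n).Finite) :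
    X.Finite ∧ X.ncard = ∑ n ∈ S, (F n).ncard := by
  classical
  have h : X = ((S.sigma fun n => (hfin n).toFinset).image
      fun z : (_ : ℤ) × ℤ × ℤ => (![z.2.1, z.2.2, z.1] : Fin 3 → ℤ) : Finset (Fin 3 → ℤ)) := by
    ext α
    rw [hX, Finset.mem_coe, Finset.mem_image]
    constructor
    · intro hα
      refine ⟨⟨α 2, α 0, α 1⟩, ?_, eq_vec_three α⟩
      rw [Finset.mem_sigma, Set.Finite.mem_toFinset]
      refine ⟨?_, hα⟩
      by_contra hn
      rw [hF _ hn] at hα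
      exact hα
    · rintro ⟨⟨n, x, y⟩, hz, rfl⟩
      rw [Finset.mem_sigma, Set.Finite.mem_toFinset] at hz
      exact hz.2
  refine ⟨h ▸ Finset.finite_toSet _, ?_⟩
  rw [h, Set.ncard_coe_finset, Finset.card_image_of_injective, Finset.card_sigma]
  · exact Finset.sum_congr rfl fun n _ => (Set.ncard_eq_toFinset_card _ (hfin n)).symm
  · rintro ⟨n, x, y⟩ ⟨n', x', y'⟩ h
    have h0 : x = x' := congrFun h 0
    have h1 : y = y' := congrFun h 1
    have h2 : n = n' := congrFun h 2
    rw [h0, h1, h2]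

/-- This is the staircase identity summed over the heights in `C`. Elsewhere slices are empty or
unbounded in both directions at once, and have no corners. -/
theorem ncard_relativeMaximals_add (hE : IsGoodSet E) {γ : Fin 3 → ℤ} (hγ : Set.Ici γ ⊆ E) :
    (relativeMaximals E).Finite ∧ (absoluteMaximals E).Finite ∧
    (relativeMaximals E).ncard +
      {n | (∃ β ∈ E, β 2 = n) ∧ ¬ ∃ β ∈ E, β 2 = n ∧ γ 0 ≤ β 0}.ncard +
      {n | (∃ β ∈ E, β 2 = n) ∧ ¬ ∃ β ∈ E, β 2 = n ∧ γ 1 ≤ β 1}.ncard =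
    (absoluteMaximals E).ncard +
      {n | (∃ β ∈ E, β 2 = n) ∧ ¬ ∃ β ∈ E, β 2 = n ∧ γ 0 ≤ β 0 ∧ γ 1 ≤ β 1}.ncard := by
  classical
  have hbdd := hE.bddBelow
  obtain ⟨l, hl⟩ := hbdd
  set A := {n | (∃ β ∈ E, β 2 = n) ∧ ¬ ∃ β ∈ E, β 2 = n ∧ γ 0 ≤ β 0} with hA
  set B := {n | (∃ β ∈ E, β 2 = n) ∧ ¬ ∃ β ∈ E, β 2 = n ∧ γ 1 ≤ β 1} with hB
  set C := {n | (∃ β ∈ E, β 2 = n) ∧ ¬ ∃ β ∈ E, β 2 = n ∧ γ 0 ≤ β 0 ∧ γ 1 ≤ β 1} with hC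
  have hCfin : C.Finite := by
    refine (Set.finite_Ico (l 2) (γ 2)).subset ?_
    rintro n ⟨⟨β, hβ, rfl⟩, hno⟩
    refine ⟨hl hβ 2, ?_⟩
    by_contra! h
    refine hno ⟨Function.update γ 2 (β 2), hγ fun k => ?_, by simp, by simp, by simp⟩
    by_cases hk : k = 2
    · subst hk; simpa using h
    · simp [hk]
  have hinf : ∀ n x y x' y', slice E n x y → slice E n x' y' →
      slice E n (min x x') (min y y') := by
    intro n x y x' y' h h'
    have := slice_of_mem (hE.inf_mem _ h _ h') (n := n) (min_self n)
    exact this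
  have hlow : ∀ n, ∃ l, ∀ x y, slice E n x y → l ≤ x := fun n => ⟨l 0, fun x y h => hl h 0⟩
  have ha : ∀ n x y, slice E n x y → γ 0 ≤ x → ∀ x', γ 0 ≤ x' → slice E n x' y := by
    intro n x y h hx x' hx'
    exact slice_of_mem (hE.update_mem hγ h (i := 0) hx hx') rfl
  have hb : ∀ n x y, slice E n x y → γ 1 ≤ y → ∀ y', γ 1 ≤ y' → slice E n x y' := by
    intro n x y h hx x' hx'
    exact slice_of_mem (hE.update_mem hγ h (i := 1) hx hx') rfl
  have hfin := fun n => finite_corners (hinf n) (hlow n) (ha n) (hb n)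
  have hnot : ∀ n ∉ hCfin.toFinset, (∃ x y, slice E n x y) →
      ∀ m, ∃ x y, m ≤ x ∧ m ≤ y ∧ slice E n x y := by
    rintro n hn ⟨x, y, h⟩ m
    rw [Set.Finite.mem_toFinset] at hn
    have : ∃ β ∈ E, β 2 = n ∧ γ 0 ≤ β 0 ∧ γ 1 ≤ β 1 := by
      by_contra hno
      exact hn ⟨⟨_, h, rfl⟩, hno⟩
    obtain ⟨β, hβ, h2, h0, h1⟩ := this
    refine ⟨max m (γ 0), max m (γ 1), le_max_left _ _, le_max_left _ _, ?_⟩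
    exact hb _ _ _ (ha _ _ _ (slice_of_mem hβ h2) h0 _ (le_max_right _ _)) h1 _ (le_max_right _ _)
  have hin : ∀ n ∉ hCfin.toFinset, innerCorners (slice E n) = ∅ := by
    intro n hn
    rw [Set.eq_empty_iff_forall_notMem]
    rintro ⟨x, y⟩ ⟨hQ, h, -⟩
    obtain ⟨x', y', hx', hy', hQ'⟩ := hnot n hn ⟨x, y, hQ⟩ (max x y + 1)
    have := h x' y' hQ' (by simp only; omega)
    simp only at this
    omega
  have hout : ∀ n ∉ hCfin.toFinset, outerCorners (slice E n) = ∅ := by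
    intro n hn
    rw [Set.eq_empty_iff_forall_notMem]
    rintro ⟨x, y⟩ ⟨hQ, h⟩
    obtain ⟨x', y', hx', hy', hQ'⟩ := hnot n hn ⟨x, y, hQ⟩ (max x y + 1)
    have := (h x' y' hQ' (by simp only; omega) (by simp only; omega)).1
    simp only at this
    omega
  obtain ⟨hRf, hR⟩ := ncard_of_slices (mem_relativeMaximals_iff hE) hin fun n => (hfin n).1
  obtain ⟨hAf, hAc⟩ := ncard_of_slices (mem_absoluteMaximals_iff hE) hout fun n => (hfin n).2
  refine ⟨hRf, hAf, ?_⟩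
  -- Both `A` and `B` lie in `C`, so their cardinalities become sums over `C` of the boundedness
  -- indicators in the staircase identity.
  have hsub : ∀ (D : Set ℤ) (p : ℤ → Prop), D ⊆ C → (∀ n ∈ C, n ∈ D ↔ ¬ p n) →
      D.ncard = ∑ n ∈ hCfin.toFinset, if p n then 0 else 1 := by
    intro D p hDC hD
    have : D = ((hCfin.toFinset.filter fun n => ¬ p n : Finset ℤ) : Set ℤ) := by
      ext n
      simp only [Finset.coe_filter, Set.Finite.mem_toFinset, Set.mem_ofPred_eq]
      exact ⟨fun h => ⟨hDC h, (hD n (hDC h)).1 h⟩, fun h => (hD n h.1).2 h.2⟩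
    rw [this, Set.ncard_coe_finset, Finset.card_filter]
    exact Finset.sum_congr rfl fun n _ => by split_ifs <;> simp_all
  have hAs := hsub A (fun n => ∃ x y, γ 0 ≤ x ∧ slice E n x y)
    (fun n ⟨h1, h2⟩ => ⟨h1, fun ⟨β, hβ, h3, h4, _⟩ => h2 ⟨β, hβ, h3, h4⟩⟩) (fun n hn => by
      refine ⟨fun h ⟨x, y, hx, hQ⟩ => h.2 ⟨_, hQ, rfl, hx⟩, fun h => ⟨hn.1, ?_⟩⟩
      rintro ⟨β, hβ, h2, h0⟩
      exact h ⟨_, _, h0, slice_of_mem hβ h2⟩)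
  have hBs := hsub B (fun n => ∃ x y, γ 1 ≤ y ∧ slice E n x y)
    (fun n ⟨h1, h2⟩ => ⟨h1, fun ⟨β, hβ, h3, _, h4⟩ => h2 ⟨β, hβ, h3, h4⟩⟩) (fun n hn => by
      refine ⟨fun h ⟨x, y, hy, hQ⟩ => h.2 ⟨_, hQ, rfl, hy⟩, fun h => ⟨hn.1, ?_⟩⟩
      rintro ⟨β, hβ, h2, h0⟩
      exact h ⟨_, _, h0, slice_of_mem hβ h2⟩)
  rw [hR, hAc, hAs, hBs, Set.ncard_eq_toFinset_card C hCfin, Finset.card_eq_sum_ones,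
    ← Finset.sum_add_distrib, ← Finset.sum_add_distrib, ← Finset.sum_add_distrib]
  refine Finset.sum_congr rfl fun n hn => ?_
  rw [Set.Finite.mem_toFinset] at hn
  obtain ⟨⟨β, hβ, h2⟩, hno⟩ := hn
  convert ncard_innerCorners_add (hinf n) (hlow n) ⟨_, _, slice_of_mem hβ h2⟩ (ha n) (hb n) ?_
  rintro ⟨x, y, hx, hy, hQ⟩
  exact hno ⟨_, hQ, rfl, hx, hy⟩

end Slices
end AdmissibleRing

end

/-! ### The length formula, and its application to value sets. -/

section

namespace AdmissibleRing

theorem ncard_mem_Ico_add_ncard_not {A : Set ℤ} {p : ℤ → Prop} {a b : ℤ} (hp : ∀ n, p n → n ∈ A)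
    (hA : ∀ n ∈ A, ¬ p n → n ∈ Set.Ico a b) :
    {n | n ∈ Set.Ico a b ∧ p n}.ncard + {n | n ∈ A ∧ ¬ p n}.ncard =
      {n | n ∈ Set.Ico a b ∧ n ∈ A}.ncard := by
  have hfin : {n | n ∈ Set.Ico a b ∧ n ∈ A}.Finite :=
    (Set.finite_Ico a b).subset fun n hn => hn.1
  rw [← ncard_sep_add_ncard_sep_not hfin p]
  congr 2
  · ext n
    exact ⟨fun h => ⟨⟨h.1, hp n h.2⟩, h.2⟩, fun h => ⟨h.1.1, h.2⟩⟩
  · ext n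
    exact ⟨fun h => ⟨⟨hA n h.1 h.2, h.1⟩, h.2⟩, fun h => ⟨h.1.2, h.2⟩⟩

open Classical in
/-- The length formula for a good set of triples. -/
theorem IsGoodSet.length_eq {E : Set (Fin 3 → ℤ)} (hE : IsGoodSet E) {a γ : Fin 3 → ℤ}
    (ha : IsLeast E a) (hγ : Set.Ici γ ⊆ E) {L : (Fin 3 → ℤ) → ℕ∞} (hLa : L a = 0)
    (hL : ∀ α i, L (Function.update α i (α i + 1)) =
      L α + if ∃ β ∈ E, α ≤ β ∧ β i = α i then 1 else 0) :
    ∃ n : ℕ, L γ = n ∧ (n : ℤ) =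
      ∑ i, (γ i - a i - ((gaps {m | ∃ β ∈ E, β i = m}).ncard : ℤ))
        - ∑ i, ∑ j ∈ Finset.Ioi i,
            ((maximals {β : ({i, j} : Finset (Fin 3)) → ℤ | ∃ α ∈ E, ∀ k, β k = α k}).ncard : ℤ)
        - ((relativeMaximals E).ncard : ℤ) + ((absoluteMaximals E).ncard : ℤ) := by
  have haγ : a ≤ γ := ha.2 (hγ Set.self_mem_Ici)
  have hmem : ∀ (i : Fin 3) (m : ℤ), γ i ≤ m → Function.update γ i m ∈ E := fun i m hm =>
    hγ (Set.mem_Ici.2 (le_update_iff.2 ⟨hm, fun _ _ => le_rfl⟩))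
  have hgap : ∀ i, ({m | m ∈ Set.Ico (a i) (γ i) ∧ ∃ β ∈ E, β i = m}.ncard : ℤ) =
      γ i - a i - (gaps {m | ∃ β ∈ E, β i = m}).ncard := fun i =>
    (ncard_mem_Ico_add_ncard_gaps (A := {m | ∃ β ∈ E, β i = m})
      ⟨⟨a, ha.1, rfl⟩, fun m ⟨β, hβ, h⟩ => h ▸ ha.2 hβ i⟩
      (fun m hm => ⟨_, hmem i m hm, by simp⟩) (haγ i)).2
  have hlow : ∀ (i : Fin 3) (p : ℤ → Prop), (∀ m, γ i ≤ m → p m) →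
      ∀ m ∈ {m | ∃ β ∈ E, β i = m}, ¬ p m → m ∈ Set.Ico (a i) (γ i) := by
    rintro i p hp m ⟨β, hβ, rfl⟩ h
    refine ⟨ha.2 hβ i, ?_⟩
    by_contra! h'
    exact h (hp _ h')
  -- The three legs of the path from `a` to `γ`; each starts with the earlier coordinates already at
  -- those of `γ`.
  have h1 := length_path hL a 0 (haγ 0)
  have h2 := length_path hL (Function.update a 0 (γ 0)) 1 (b := γ 1) (by simpa using haγ 1)
  have h3 := length_path hL (Function.update (Function.update a 0 (γ 0)) 1 (γ 1)) 2 (b := γ 2)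
    (by simpa using haγ 2)
  have hend : Function.update (Function.update (Function.update a 0 (γ 0)) 1 (γ 1)) 2 (γ 2) = γ := by
    ext i
    fin_cases i <;> simp
  have e1 : {n | n ∈ Set.Ico (a 0) (γ 0) ∧ ∃ β ∈ E, β 0 = n ∧ ∀ j ≠ 0, a j ≤ β j} =
      {n | n ∈ Set.Ico (a 0) (γ 0) ∧ ∃ β ∈ E, β 0 = n} := by
    ext n
    refine and_congr_right fun _ => exists_congr fun β => and_congr_right fun hβ => ?_
    exact and_iff_left fun j _ => ha.2 hβ j
  have e2 : {n | n ∈ Set.Ico ((Function.update a 0 (γ 0)) 1) (γ 1) ∧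
      ∃ β ∈ E, β 1 = n ∧ ∀ j ≠ 1, (Function.update a 0 (γ 0)) j ≤ β j} =
      {n | n ∈ Set.Ico (a 1) (γ 1) ∧ ∃ β ∈ E, β 1 = n ∧ γ 0 ≤ β 0} := by
    ext n
    refine and_congr (by simp) (exists_congr fun β => and_congr_right fun hβ =>
      and_congr_right fun _ => ⟨fun h => by simpa using h 0 (by decide), fun h j hj => ?_⟩)
    fin_cases j
    · simpa using h
    · simp at hj
    · simpa using ha.2 hβ 2
  have e3 : {n | n ∈ Set.Ico ((Function.update (Function.update a 0 (γ 0)) 1 (γ 1)) 2) (γ 2) ∧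
      ∃ β ∈ E, β 2 = n ∧ ∀ j ≠ 2, (Function.update (Function.update a 0 (γ 0)) 1 (γ 1)) j ≤ β j} =
      {n | n ∈ Set.Ico (a 2) (γ 2) ∧ ∃ β ∈ E, β 2 = n ∧ γ 0 ≤ β 0 ∧ γ 1 ≤ β 1} := by
    ext n
    refine and_congr (by simp) (exists_congr fun β => and_congr_right fun hβ =>
      and_congr_right fun _ => ⟨fun h => ⟨by simpa using h 0 (by decide),
        by simpa using h 1 (by decide)⟩, fun h j hj => ?_⟩)
    fin_cases j
    · simpa using h.1
    · simpa using h.2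
    · simp at hj
  rw [e1, hLa, zero_add] at h1
  rw [e2, h1] at h2
  rw [e3, h2, hend] at h3
  -- On the second and third legs, the values counted and the values lost together make up all
  -- values of `E` in the interval.
  have c2 := ncard_mem_Ico_add_ncard_not (A := {m | ∃ β ∈ E, β 1 = m})
    (p := fun n => ∃ β ∈ E, β 1 = n ∧ γ 0 ≤ β 0) (a := a 1) (b := γ 1)
    (fun n ⟨β, hβ, h, _⟩ => ⟨β, hβ, h⟩)
    (hlow 1 _ fun m hm => ⟨_, hmem 1 m hm, by simp, by simp⟩)
  have c3 := ncard_mem_Ico_add_ncard_not (A := {m | ∃ β ∈ E, β 2 = m})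
    (p := fun n => ∃ β ∈ E, β 2 = n ∧ γ 0 ≤ β 0 ∧ γ 1 ≤ β 1) (a := a 2) (b := γ 2)
    (fun n ⟨β, hβ, h, _⟩ => ⟨β, hβ, h⟩)
    (hlow 2 _ fun m hm => ⟨_, hmem 2 m hm, by simp, by simp, by simp⟩)
  have m01 := (hE.maximals_restrict_pair hγ (show (0 : Fin 3) ≠ 1 by decide)).2
  have m02 := (hE.maximals_restrict_pair hγ (show (0 : Fin 3) ≠ 2 by decide)).2
  have m12 := (hE.maximals_restrict_pair hγ (show (1 : Fin 3) ≠ 2 by decide)).2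
  have hRA := (ncard_relativeMaximals_add hE hγ).2.2
  refine ⟨_, h3.trans rfl, ?_⟩
  have i0 : Finset.Ioi (0 : Fin 3) = {1, 2} := by decide
  have i1 : Finset.Ioi (1 : Fin 3) = {2} := by decide
  have i2 : Finset.Ioi (2 : Fin 3) = ∅ := by decide
  have g0 := hgap 0
  have g1 := hgap 1
  have g2 := hgap 2
  rw [Fin.sum_univ_three, Fin.sum_univ_three, i0, i1, i2, Finset.sum_pair (by decide),
    Finset.sum_singleton, Finset.sum_empty, ← g0, ← g1, ← g2]
  simp only [Set.mem_ofPred_eq] at c2 c3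
  rw [m01, m02, m12]
  push_cast
  zify at c2 c3 hRA
  linarith

section ValueSets

open scoped nonZeroDivisors

variable {R : Type*} [CommRing R] [IsLocalRing R]

/-- `E_J` is the projection of `E`: an element with finite values on `J` can be altered, only where
its value is infinite, to have finite values everywhere. -/
theorem IsCompleteAdmissible.mem_partialValueSet_iff_exists_mem_valueSet
    (hR : IsCompleteAdmissible R) {ι : Type*} [Finite ι] (p : ι ≃ minimalPrimes R)
    (𝓘 : FractionalIdeal R⁰ (FractionRing R))
    (h𝓘 : ∃ d ∈ R⁰, algebraMap R (FractionRing R) d ∈ 𝓘) (J : Finset ι) (β : J → ℤ) :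
    β ∈ partialValueSet p 𝓘 J ↔ ∃ α ∈ valueSet p 𝓘, ∀ k : J, β k = α k := by
  have := hR.isReduced
  have := Finite.of_equiv _ p
  rw [mem_partialValueSet_iff]
  constructor
  · rintro ⟨h, hh, hβ⟩
    obtain ⟨N, hN⟩ := hR.exists_forall_le_branchVal_imp_mem 𝓘 h𝓘
    obtain ⟨α, hα, hα'⟩ := (hR.isValuationFamily p).exists_finite_values
      (I := (𝓘 : Submodule R (FractionRing R)))
      ⟨N, fun h hh => hN h fun P => by
        obtain ⟨i, rfl⟩ := p.surjective P
        exact hh i⟩ hh 0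
    refine ⟨α, (mem_valueSet_iff p 𝓘 α).2 hα, fun k => ?_⟩
    rcases hα' k with h1 | ⟨h1, -⟩
    · rw [hβ k, WithTop.coe_eq_coe] at h1
      exact h1
    · rw [hβ k] at h1
      exact absurd h1 WithTop.coe_ne_top
  · rintro ⟨α, hα, hβ⟩
    obtain ⟨h, hh, hα⟩ := (mem_valueSet_iff p 𝓘 α).1 hα
    exact ⟨h, hh, fun k => by rw [hβ k]; exact hα k⟩

end ValueSets
end AdmissibleRing

end

open AdmissibleRing in
theorem theorem18 {R : Type*} [CommRing R] [IsLocalRing R]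
    (hR : AdmissibleRing.IsCompleteAdmissible R)
    (p : Fin 3 ≃ minimalPrimes R)
    (𝓘 : FractionalIdeal (nonZeroDivisors R) (FractionRing R))
    (h𝓘 : ∃ d ∈ nonZeroDivisors R, algebraMap R (FractionRing R) d ∈ 𝓘)
    (E : Set (Fin 3 → ℤ)) (hE : E = AdmissibleRing.valueSet p 𝓘) :
    (∀ i, IsDiscreteValuationRing (AdmissibleRing.BranchNormalization (p i))) ∧
    ∃ α₀ c : Fin 3 → ℤ, IsLeast E α₀ ∧ AdmissibleRing.IsConductor E c ∧
      (∀ i, (AdmissibleRing.gaps (AdmissibleRing.singleValueSet p 𝓘 i)).Finite) ∧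
      (∀ i j, i < j →
        (AdmissibleRing.maximals (AdmissibleRing.partialValueSet p 𝓘 {i, j})).Finite) ∧
      (AdmissibleRing.relativeMaximals E).Finite ∧
      (AdmissibleRing.absoluteMaximals E).Finite ∧
      ∀ γ : Fin 3 → ℤ, c ≤ γ →
        ∃ n : ℕ,
          Module.length R ((𝓘 : Submodule R (FractionRing R)) ⧸
            (AdmissibleRing.truncation p 𝓘 γ).submoduleOf
              (𝓘 : Submodule R (FractionRing R))) = n ∧
          (n : ℤ) =
            ∑ i, ((γ i - α₀ i)
              - ((AdmissibleRing.gaps (AdmissibleRing.singleValueSet p 𝓘 i)).ncard : ℤ))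
            - ∑ i, ∑ j ∈ Finset.Ioi i,
                ((AdmissibleRing.maximals
                  (AdmissibleRing.partialValueSet p 𝓘 {i, j})).ncard : ℤ)
            - ((AdmissibleRing.relativeMaximals E).ncard : ℤ)
            + ((AdmissibleRing.absoluteMaximals E).ncard : ℤ) := by
  classical
  have := hR.isReduced
  have := Finite.of_equiv _ p
  have hw := hR.isValuationFamily p
  have hN : ∃ N : ℤ, ∀ h : FractionRing R,
      (∀ i, (N : WithTop ℤ) ≤ branchVal (p i) (projBranch (p i) h)) →
        h ∈ (𝓘 : Submodule R (FractionRing R)) := by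
    obtain ⟨N, hN⟩ := hR.exists_forall_le_branchVal_imp_mem 𝓘 h𝓘
    exact ⟨N, fun h hh => hN h fun P => by
        obtain ⟨i, rfl⟩ := p.surjective P
        exact hh i⟩
  have hB : ∃ B : ℤ, ∀ h ∈ (𝓘 : Submodule R (FractionRing R)), ∀ i,
      (B : WithTop ℤ) ≤ branchVal (p i) (projBranch (p i) h) := by
    obtain ⟨B, hB⟩ := hR.exists_forall_mem_le_branchVal 𝓘
    exact ⟨B, fun h hh i => hB h hh (p i)⟩
  have hk : ENat.card (Fin 3) ≤ ENat.card (IsLocalRing.ResidueField R) := by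
    rw [ENat.card_congr p]
    exact hR.residueField_large
  have hEeq : E = {α | ∃ h ∈ (𝓘 : Submodule R (FractionRing R)),
      ∀ i, branchVal (p i) (projBranch (p i) h) = (α i : WithTop ℤ)} :=
    hE.trans (Set.ext fun α => mem_valueSet_iff p 𝓘 α)
  have hgood : IsGoodSet E := hEeq ▸ hw.isGoodSet hk hN hB
  have hpartial : ∀ J : Finset (Fin 3), partialValueSet p 𝓘 J =
      {β | ∃ α ∈ E, ∀ k : J, β k = α k} := fun J => Set.ext fun β => by
    rw [hR.mem_partialValueSet_iff_exists_mem_valueSet p 𝓘 h𝓘, ← hE]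
    rfl
  have hsingle : ∀ i, singleValueSet p 𝓘 i = {m | ∃ β ∈ E, β i = m} := fun i => Set.ext fun m => by
    rw [singleValueSet, hpartial]
    refine exists_congr fun β => and_congr_right fun _ => ⟨fun h => (h ⟨i, by simp⟩).symm, ?_⟩
    rintro rfl ⟨k, hk⟩
    rw [Finset.mem_singleton] at hk
    subst hk
    rfl
  obtain ⟨a, ha⟩ := hgood.exists_isLeast
  obtain ⟨c, hc⟩ := hgood.exists_isConductor
  have hac : a ≤ c := ha.2 (hc.1 Set.self_mem_Ici)
  simp only [hsingle, hpartial]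
  refine ⟨fun i => hR.isDiscreteValuationRing_branchNormalization (p i), a, c, ha, hc, fun i => ?_,
    fun i j hij => (hgood.maximals_restrict_pair hc.1 hij.ne).1,
    (ncard_relativeMaximals_add hgood hc.1).1, (ncard_relativeMaximals_add hgood hc.1).2.1,
    fun γ hγ => ?_⟩
  · refine (ncard_mem_Ico_add_ncard_gaps (A := {m | ∃ β ∈ E, β i = m}) (a := a i) (b := c i)
      ⟨⟨a, ha.1, rfl⟩, fun m ⟨β, hβ, h⟩ => h ▸ ha.2 hβ i⟩ (fun m hm => ⟨Function.update c i m,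
        hc.1 (Set.mem_Ici.2 (le_update_iff.2 ⟨hm, fun _ _ => le_rfl⟩)), by simp⟩) (hac i)).1
  · have hT : ∀ α h, h ∈ truncation p 𝓘 α ↔ h ∈ (𝓘 : Submodule R (FractionRing R)) ∧
        ∀ i, (α i : WithTop ℤ) ≤ branchVal (p i) (projBranch (p i) h) := fun _ _ => Iff.rfl
    refine hgood.length_eq ha ((Set.Ici_subset_Ici.2 hγ).trans hc.1)
      (L := fun γ => Module.length R ((𝓘 : Submodule R (FractionRing R)) ⧸
        (truncation p 𝓘 γ).submoduleOf (𝓘 : Submodule R (FractionRing R)))) ?_ fun α i => ?_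
    · rw [Module.length_eq_zero_iff, Submodule.Quotient.subsingleton_iff, eq_top_iff]
      rintro ⟨h, hh⟩ -
      rw [Submodule.submoduleOf, Submodule.mem_comap, Submodule.subtype_apply, hT]
      obtain ⟨M, hM⟩ := (Set.finite_range a).bddAbove
      -- `𝓘(α⁰) = 𝓘`, also for zero divisors: each finite value of `h` is a coordinate of a point of
      -- `E`, hence at least that of `α⁰`.
      obtain ⟨β, hβ, hβ'⟩ := hw.exists_finite_values hN hh M
      refine ⟨hh, fun i => ?_⟩
      rcases hβ' i with h1 | ⟨h1, -⟩
      · rw [h1, WithTop.coe_le_coe]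
        exact ha.2 (hEeq ▸ hβ) i
      · rw [h1]
        exact le_top
    · rw [hEeq]
      exact hw.length_quotient_truncation_update hN hT α i
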